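/- Let $m\ge 0$, let $n_1,\dots,n_m\ge 1$ be integers, and let $\Gamma=\bigoplus_{i=1}^m\mathbb Z/n_i\mathbb Z$. Write an element of $\Gamma$ as $a=(a_1,\dots,a_m)$, let $(k_1,\dots,k_r)$ denote the greatest common divisor, let $\mathbb T$ be the unit circle with trivial $\Gamma$-action, let $\chi_N$ be the character of $\mathbb Z/N\mathbb Z$ with $\chi_N(1)=e^{2\pi i/N}$, and put $$\omega_N(x,y)=\Bigl\lfloor\frac{x+y}{N}\Bigr\rfloor-\Bigl\lfloor\frac{x}{N}\Bigr\rfloor-\Bigl\lfloor\frac{y}{N}\Bigr\rfloor\qquad(x,y\in\mathbb Z),$$ which depends only on $x$ and $y$ modulo $N$ and so is a function on $\mathbb Z/N\mathbb Z\times\mathbb Z/N\mathbb Z$. Define functions $\Gamma^3\to\mathbb T$ by $$\phi_i(a,b,c)=\chi_{n_i}\bigl(\omega_{n_i}(a_i,b_i)c_i\bigr),\qquad \phi_{ij}(a,b,c)=\chi_{n_j}\bigl(\omega_{n_i}(a_i,b_i)c_j\bigr)\ (i<j),\qquad \phi_{ijk}(a,b,c)=\chi_{(n_i,n_j,n_k)}(a_ib_jc_k)\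 (i<j<k).$$ Then all the functions $\phi_i$, $\phi_{ij}$, $\phi_{ijk}$ are $3$-cocycles in the standard inhomogeneous complex computing group cohomology, and there is an isomorphism of abelian groups $$\bigoplus_{i}\mathbb Z/n_i\mathbb Z\ \oplus\ \bigoplus_{i<j}\mathbb Z/(n_i,n_j)\mathbb Z\ \oplus\ \bigoplus_{i<j<k}\mathbb Z/(n_i,n_j,n_k)\mathbb Z\ \cong\ H^3(\Gamma;\mathbb T)$$ under which the generators $1$ of the summands $\mathbb Z/n_i\mathbb Z$, $\mathbb Z/(n_i,n_j)\mathbb Z$ and $\mathbb Z/(n_i,n_j,n_k)\mathbb Z$ correspond to the cohomology classes of $\phi_i$, $\phi_{ij}$ and $\phi_{ijk}$, respectively. -/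

import Mathlib

open scoped DirectSum

noncomputable section

namespace ThirdCohomology

/-- `ω_n(a, b) = ⌊(a + b) / n⌋ - ⌊a / n⌋ - ⌊b / n⌋` for integers `a`, `b`. -/
def omega (n : ℕ) (a b : ℤ) : ℤ :=
  ⌊((a : ℚ) + (b : ℚ)) / (n : ℚ)⌋ - ⌊(a : ℚ) / (n : ℚ)⌋ - ⌊(b : ℚ) / (n : ℚ)⌋

/-- `ω_n` as a function on `ℤ/n × ℤ/n`, computed on the representatives in `{0, …, n - 1}`;
`omegaZMod_intCast` says that any other representatives give the same value. -/
def omegaZMod (n : ℕ) (x y : ZMod n) : ℤ :=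
  omega n (x.val : ℤ) (y.val : ℤ)

theorem omega_add_mul (n : ℕ) [NeZero n] (a b k l : ℤ) :
    omega n (a + n * k) (b + n * l) = omega n a b := by
  have hn : (n : ℚ) ≠ 0 := Nat.cast_ne_zero.mpr (NeZero.ne n)
  have h1 : (((a + n * k : ℤ) : ℚ) + ((b + n * l : ℤ) : ℚ)) / (n : ℚ)
      = ((a : ℚ) + b) / n + ((k + l : ℤ) : ℚ) := by
    push_cast; field_simp; ring
  have h2 : ((a + n * k : ℤ) : ℚ) / (n : ℚ) = (a : ℚ) / n + ((k : ℤ) : ℚ) := by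
    push_cast; field_simp
  have h3 : ((b + n * l : ℤ) : ℚ) / (n : ℚ) = (b : ℚ) / n + ((l : ℤ) : ℚ) := by
    push_cast; field_simp
  unfold omega
  rw [h1, h2, h3, Int.floor_add_intCast, Int.floor_add_intCast, Int.floor_add_intCast]
  ring

theorem omegaZMod_intCast (n : ℕ) [NeZero n] (a b : ℤ) :
    omegaZMod n (a : ZMod n) (b : ZMod n) = omega n a b := by
  have h : ∀ x : ℤ, (((x : ZMod n).val : ℕ) : ℤ) = x + n * (-(x / n)) := by
    intro x
    rw [ZMod.val_intCast, Int.emod_def]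
    ring
  unfold omegaZMod
  rw [h a, h b, omega_add_mul]

variable {m : ℕ} (n : Fin m → ℕ)

/-- The group `Γ = ⨁ᵢ ℤ/nᵢ` (finitely many summands, so the direct sum is the product). -/
abbrev Gam : Type := ∀ i : Fin m, ZMod (n i)

/-- The greatest common divisor `(nᵢ, nⱼ)`. -/
abbrev gcd₂ (i j : Fin m) : ℕ := Nat.gcd (n i) (n j)

/-- The greatest common divisor `(nᵢ, nⱼ, nₖ)`. -/
abbrev gcd₃ (i j k : Fin m) : ℕ := Nat.gcd (Nat.gcd (n i) (n j)) (n k)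

theorem gcd₃_dvd₁ (i j k : Fin m) : gcd₃ n i j k ∣ n i :=
  (Nat.gcd_dvd_left _ _).trans (Nat.gcd_dvd_left _ _)

theorem gcd₃_dvd₂ (i j k : Fin m) : gcd₃ n i j k ∣ n j :=
  (Nat.gcd_dvd_left _ _).trans (Nat.gcd_dvd_right _ _)

theorem gcd₃_dvd₃ (i j k : Fin m) : gcd₃ n i j k ∣ n k :=
  Nat.gcd_dvd_right _ _

instance gcd₃_neZero [∀ i, NeZero (n i)] (i j k : Fin m) : NeZero (gcd₃ n i j k) :=
  ⟨fun h => NeZero.ne (n k) (Nat.eq_zero_of_zero_dvd (h ▸ gcd₃_dvd₃ n i j k))⟩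

/-- The cochain `φᵢ(a, b, c) = χ_{nᵢ}(ω_{nᵢ}(aᵢ, bᵢ) cᵢ)`. Here `χ_N` is `ZMod.toCircle`, the
character of `ℤ/N` with `χ_N(1) = exp(2πi/N)`. -/
def phi₁ [∀ i, NeZero (n i)] (i : Fin m) (a b c : Gam n) : Circle :=
  ZMod.toCircle ((omegaZMod (n i) (a i) (b i) : ZMod (n i)) * c i)

/-- The cochain `φᵢⱼ(a, b, c) = χ_{nⱼ}(ω_{nᵢ}(aᵢ, bᵢ) cⱼ)`. -/
def phi₂ [∀ i, NeZero (n i)] (i j : Fin m) (a b c : Gam n) : Circle :=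
  ZMod.toCircle ((omegaZMod (n i) (a i) (b i) : ZMod (n j)) * c j)

/-- The cochain `φᵢⱼₖ(a, b, c) = χ_{(nᵢ, nⱼ, nₖ)}(aᵢ bⱼ cₖ)`, the product being taken after
reducing the three coordinates modulo `(nᵢ, nⱼ, nₖ)`. -/
def phi₃ [∀ i, NeZero (n i)] (i j k : Fin m) (a b c : Gam n) : Circle :=
  ZMod.toCircle (N := gcd₃ n i j k)
    (ZMod.castHom (gcd₃_dvd₁ n i j k) (ZMod (gcd₃ n i j k)) (a i) *
      ZMod.castHom (gcd₃_dvd₂ n i j k) (ZMod (gcd₃ n i j k)) (b j) *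
      ZMod.castHom (gcd₃_dvd₃ n i j k) (ZMod (gcd₃ n i j k)) (c k))

/-- The circle group `𝕋`, as a trivial module over the group `Γ`, for an abelian group `Γ`.
(Mathlib's group cohomology wants a multiplicative group and an additive coefficient module.) -/
abbrev coeff (Γ : Type) [AddCommGroup Γ] : Rep ℤ (Multiplicative Γ) :=
  Rep.trivial ℤ (Multiplicative Γ) (Additive Circle)

/-- The third cohomology group `H³(Γ; 𝕋)` of an abelian group `Γ` with trivial action on `𝕋`. -/
abbrev H3 (Γ : Type) [AddCommGroup Γ] : Type := groupCohomology (coeff Γ) 3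

/-- A function of three variables in `Γ` with values in `𝕋`, as an inhomogeneous `3`-cochain. -/
def cochain {Γ : Type} [AddCommGroup Γ] (f : Γ → Γ → Γ → Circle) :
    (Fin 3 → Multiplicative Γ) → coeff Γ :=
  fun g => Additive.ofMul (f (g 0).toAdd (g 1).toAdd (g 2).toAdd)

/-- `f` is a `𝕋`-valued `3`-cocycle on `Γ`: the coboundary of `f` is trivial. -/
def IsCocycle {Γ : Type} [AddCommGroup Γ] (f : Γ → Γ → Γ → Circle) : Prop :=
  inhomogeneousCochains.d (coeff Γ) 3 (cochain f) = 0

/-- The cohomology class in `H³(Γ; 𝕋)` of a `3`-cocycle. -/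
def cohomologyClass {Γ : Type} [AddCommGroup Γ] (f : Γ → Γ → Γ → Circle) (hf : IsCocycle f) :
    H3 Γ :=
  groupCohomology.π (coeff Γ) 3 (groupCohomology.cocyclesMk (cochain f) hf)

/-- Pairs of indices `i < j`. -/
abbrev Pairs (m : ℕ) : Type := {p : Fin m × Fin m // p.1 < p.2}

/-- Triples of indices `i < j < k`. -/
abbrev Triples (m : ℕ) : Type := {p : Fin m × Fin m × Fin m // p.1 < p.2.1 ∧ p.2.1 < p.2.2}

/-- `⨁ᵢ ℤ/nᵢ ⊕ ⨁_{i<j} ℤ/(nᵢ, nⱼ) ⊕ ⨁_{i<j<k} ℤ/(nᵢ, nⱼ, nₖ)`. -/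
abbrev Target : Type :=
  (⨁ i : Fin m, ZMod (n i)) ×
    (⨁ p : Pairs m, ZMod (gcd₂ n p.1.1 p.1.2)) ×
    (⨁ p : Triples m, ZMod (gcd₃ n p.1.1 p.1.2.1 p.1.2.2))

/-- The generator `1` of the summand `ℤ/nᵢ`. -/
def gen₁ (i : Fin m) : Target n :=
  (DirectSum.of (fun i : Fin m => ZMod (n i)) i 1, 0, 0)

/-- The generator `1` of the summand `ℤ/(nᵢ, nⱼ)`. -/
def gen₂ (p : Pairs m) : Target n :=
  (0, DirectSum.of (fun p : Pairs m => ZMod (gcd₂ n p.1.1 p.1.2)) p 1, 0)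

/-- The generator `1` of the summand `ℤ/(nᵢ, nⱼ, nₖ)`. -/
def gen₃ (p : Triples m) : Target n :=
  (0, 0, DirectSum.of (fun p : Triples m => ZMod (gcd₃ n p.1.1 p.1.2.1 p.1.2.2)) p 1)

end ThirdCohomology

end

/-! The class of φ_ij is killed by (n_i, n_j): n_j φ_ij = 0, while n_i ω_{n_i} is the coboundary of
the lift to {0, …, n_i - 1}, so n_i φ_ij is a coboundary. Likewise (n_i, n_j, n_k) φ_ijk = 0. This
gives the map `targetHom`, with φ_i treated as the case j = i of φ_ij.

Injectivity uses two invariants that vanish on coboundaries: the alternation `alt₃ f`, and the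
cyclic sum of f(g, tg, g) over 0 ≤ t < L when Lg = 0. Evaluated at unit vectors e_i and at sums e_i
+ e_j, they recover the coefficients of a combination of the φ's modulo the relevant gcds
(`coeff_eq_zero`).

Surjectivity is an induction on the number of coordinates, an explicit form of the spectral sequence
of a cyclic quotient. Subtracting the part pulled back from the coordinates below k leaves a cocycle
f in the coordinates up to k that vanishes once the k-th is set to 0. As `alt₃ f` is trilinear, its
value at (e_i, e_j, e_k) is torsion of order dividing the gcd, so a combination of the φ_ijk removes
it. Now f is trivialized by a homogeneous 2-cochain F invariant under the kernel of the k-th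
coordinate. The change of F under translation by e_k yields a 2-cocycle on that kernel, symmetric
because the alternation vanishes, hence a coboundary because the circle is divisible. The resulting
1-cochain E has as its norm a character χ of Γ (`exists_descent`). If χ = 0, then f is a coboundary
(`mem_B₃_of_descent`). Since φ_ik realizes minus the i-th coordinate character
(`Phi₂_mem_descentGroup`), a combination of the φ_ik cancels any χ. -/

open scoped DirectSum

noncomputable section

namespace ThirdCohomology

/-! ### Inhomogeneous cochains in curried form -/

section Cochains

variable {Γ A : Type} [AddCommGroup Γ] [AddCommGroup A]

/-- The coboundary of an inhomogeneous `2`-cochain, for the trivial action. -/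
def d₂ (ψ : Γ → Γ → A) (a b c : Γ) : A :=
  ψ b c - ψ (a + b) c + ψ a (b + c) - ψ a b

/-- The coboundary of an inhomogeneous `3`-cochain, for the trivial action. -/
def d₃ (f : Γ → Γ → Γ → A) (a b c e : Γ) : A :=
  f b c e - f (a + b) c e + f a (b + c) e - f a b (c + e) + f a b c

theorem d₃_d₂ (ψ : Γ → Γ → A) (a b c e : Γ) : d₃ (d₂ ψ) a b c e = 0 := by
  simp only [d₃, d₂, add_assoc]
  abel

variable (Γ A) in
/-- The group of inhomogeneous `3`-cocycles, for the trivial action. -/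
def Z₃ : AddSubgroup (Γ → Γ → Γ → A) where
  carrier := {f | ∀ a b c e, d₃ f a b c e = 0}
  zero_mem' a b c e := by simp [d₃]
  add_mem' {f g} hf hg a b c e := by
    have h : d₃ (f + g) a b c e = d₃ f a b c e + d₃ g a b c e := by
      simp only [d₃, Pi.add_apply]; abel
    rw [h, hf, hg, add_zero]
  neg_mem' {f} hf a b c e := by
    have h : d₃ (-f) a b c e = -d₃ f a b c e := by
      simp only [d₃, Pi.neg_apply]; abel
    rw [h, hf, neg_zero]

theorem mem_Z₃ {f : Γ → Γ → Γ → A} : f ∈ Z₃ Γ A ↔ ∀ a b c e, d₃ f a b c e = 0 := Iff.rfl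

variable (Γ A) in
/-- The group of inhomogeneous `3`-coboundaries, for the trivial action. -/
def B₃ : AddSubgroup (Γ → Γ → Γ → A) where
  carrier := {f | ∃ ψ : Γ → Γ → A, d₂ ψ = f}
  zero_mem' := ⟨0, by ext; simp [d₂]⟩
  add_mem' := by
    rintro _ _ ⟨ψ, rfl⟩ ⟨ψ', rfl⟩
    exact ⟨ψ + ψ', by ext; simp only [d₂, Pi.add_apply]; abel⟩
  neg_mem' := by
    rintro _ ⟨ψ, rfl⟩
    exact ⟨-ψ, by ext; simp only [d₂, Pi.neg_apply]; abel⟩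

theorem B₃_le_Z₃ : B₃ Γ A ≤ Z₃ Γ A := by
  rintro _ ⟨ψ, rfl⟩
  exact d₃_d₂ ψ

end Cochains

/-! ### Comparison with `groupCohomology` -/

section Bridge

variable {Γ : Type} [AddCommGroup Γ]

/-- A curried cochain with values in `Additive Circle` as an inhomogeneous `3`-cochain. -/
def uncurry₃ (f : Γ → Γ → Γ → Additive Circle) : (Fin 3 → Multiplicative Γ) → coeff Γ :=
  fun g => f (g 0).toAdd (g 1).toAdd (g 2).toAdd

theorem d_uncurry₃ (f : Γ → Γ → Γ → Additive Circle) (g : Fin 4 → Multiplicative Γ) :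
    inhomogeneousCochains.d (coeff Γ) 3 (uncurry₃ f) g =
      d₃ f (g 0).toAdd (g 1).toAdd (g 2).toAdd (g 3).toAdd := by
  rw [inhomogeneousCochains.d_hom_apply]
  simp [Fin.sum_univ_four, uncurry₃, d₃, Fin.contractNth]
  abel

theorem d_eq_uncurry₃ (ψ : (Fin 2 → Multiplicative Γ) → coeff Γ) :
    inhomogeneousCochains.d (coeff Γ) 2 ψ =
      uncurry₃ (d₂ fun a b => (ψ ![.ofAdd a, .ofAdd b] : Additive Circle)) := by
  funext g
  rw [inhomogeneousCochains.d_hom_apply]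
  have h₀ : (fun i : Fin 2 => g i.succ) = ![g 1, g 2] := by
    funext i; fin_cases i <;> rfl
  have h₁ : Fin.contractNth 0 (· * ·) g = ![g 0 * g 1, g 2] := by
    funext i; fin_cases i <;> rfl
  have h₂ : Fin.contractNth 1 (· * ·) g = ![g 0, g 1 * g 2] := by
    funext i; fin_cases i <;> rfl
  have h₃ : Fin.contractNth 2 (· * ·) g = ![g 0, g 1] := by
    funext i; fin_cases i <;> rfl
  simp [Fin.sum_univ_three, uncurry₃, d₂, h₀, h₁, h₂, h₃]
  abel

theorem d_uncurry₃_eq_zero {f : Γ → Γ → Γ → Additive Circle} (hf : f ∈ Z₃ Γ (Additive Circle)) :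
    inhomogeneousCochains.d (coeff Γ) 3 (uncurry₃ f) = 0 :=
  funext fun g => (d_uncurry₃ f g).trans (hf _ _ _ _)

theorem mem_Z₃_of_d_eq_zero {f : Γ → Γ → Γ → Additive Circle}
    (h : inhomogeneousCochains.d (coeff Γ) 3 (uncurry₃ f) = 0) : f ∈ Z₃ Γ (Additive Circle) :=
  fun a b c e => (d_uncurry₃ f ![.ofAdd a, .ofAdd b, .ofAdd c, .ofAdd e]).symm.trans (congrFun h _)

theorem isCocycle_iff {F : Γ → Γ → Γ → Circle} :
    IsCocycle F ↔ (fun a b c => Additive.ofMul (F a b c)) ∈ Z₃ Γ (Additive Circle) :=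
  ⟨fun h => mem_Z₃_of_d_eq_zero h, fun h => d_uncurry₃_eq_zero h⟩

theorem iCocycles_injective :
    Function.Injective (groupCohomology.iCocycles (coeff Γ) 3) :=
  (ModuleCat.mono_iff_injective _).1 inferInstance

/-- A cocycle as an element of the module of cocycles. -/
def toCocycle (f : Z₃ Γ (Additive Circle)) : groupCohomology.cocycles (coeff Γ) 3 :=
  groupCohomology.cocyclesMk (uncurry₃ f.1) (d_uncurry₃_eq_zero f.2)

theorem iCocycles_toCocycle (f : Z₃ Γ (Additive Circle)) :
    groupCohomology.iCocycles (coeff Γ) 3 (toCocycle f) = uncurry₃ f.1 :=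
  groupCohomology.iCocycles_mk _ (d_uncurry₃_eq_zero f.2)

theorem toCocycle_surjective : Function.Surjective (toCocycle (Γ := Γ)) := by
  intro y
  let f : Γ → Γ → Γ → Additive Circle := fun a b c =>
    (groupCohomology.iCocycles (coeff Γ) 3 y : (Fin 3 → Multiplicative Γ) → Additive Circle)
      ![.ofAdd a, .ofAdd b, .ofAdd c]
  have hf : uncurry₃ f = groupCohomology.iCocycles (coeff Γ) 3 y := by
    funext g
    have : ![g 0, g 1, g 2] = g := by
      funext i; fin_cases i <;> rfl
    exact congrArg
      (groupCohomology.iCocycles (coeff Γ) 3 y : (Fin 3 → Multiplicative Γ) → Additive Circle) this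
  have hy : inhomogeneousCochains.d (coeff Γ) 3 (groupCohomology.iCocycles (coeff Γ) 3 y) = 0 := by
    have h := (groupCohomology.inhomogeneousCochains (coeff Γ)).iCycles_d 3 4
    rw [groupCohomology.inhomogeneousCochains.d_def] at h
    exact congrArg (fun φ => φ y) h
  refine ⟨⟨f, mem_Z₃_of_d_eq_zero (hf ▸ hy)⟩, iCocycles_injective ?_⟩
  rw [iCocycles_toCocycle, hf]

/-- The cohomology class of a `3`-cocycle, as a homomorphism. -/
def classHom (Γ : Type) [AddCommGroup Γ] : Z₃ Γ (Additive Circle) →+ H3 Γ where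
  toFun f := groupCohomology.π (coeff Γ) 3 (toCocycle f)
  map_zero' := by
    have : toCocycle (0 : Z₃ Γ (Additive Circle)) = 0 := by
      apply iCocycles_injective
      rw [iCocycles_toCocycle, map_zero]
      rfl
    rw [this, map_zero]
  map_add' f g := by
    have : toCocycle (f + g) = toCocycle f + toCocycle g := by
      apply iCocycles_injective
      rw [iCocycles_toCocycle, map_add, iCocycles_toCocycle, iCocycles_toCocycle]
      rfl
    rw [this, map_add]

theorem classHom_surjective : Function.Surjective (classHom Γ) := by
  intro x
  induction x using groupCohomology_induction_on with
  | h y =>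
    obtain ⟨f, rfl⟩ := toCocycle_surjective y
    exact ⟨f, rfl⟩

theorem classHom_eq_zero_iff (f : Z₃ Γ (Additive Circle)) :
    classHom Γ f = 0 ↔ f.1 ∈ B₃ Γ (Additive Circle) := by
  have key : ∀ ψ : (Fin 2 → Multiplicative Γ) → coeff Γ, groupCohomology.iCocycles (coeff Γ) 3
      (groupCohomology.toCocycles (coeff Γ) 2 3 ψ) =
        inhomogeneousCochains.d (coeff Γ) 2 ψ := by
    intro ψ
    have h := (groupCohomology.inhomogeneousCochains (coeff Γ)).toCycles_i 2 3
    rw [groupCohomology.inhomogeneousCochains.d_def] at h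
    exact congrArg (fun φ => φ ψ) h
  -- Cohomology is the cokernel of the map from 2-cochains to 3-cocycles, so a cocycle of trivial
  -- class lifts to a 2-cochain.
  have hex : (CategoryTheory.ShortComplex.mk _ _
      ((groupCohomology.inhomogeneousCochains (coeff Γ)).toCycles_comp_homologyπ 2 3)).Exact :=
    CategoryTheory.ShortComplex.exact_of_g_is_cokernel _
      ((groupCohomology.inhomogeneousCochains (coeff Γ)).homologyIsCokernel 2 3 (by simp))
  rw [CategoryTheory.ShortComplex.moduleCat_exact_iff] at hex
  constructor
  · intro h
    obtain ⟨ψ, hψ⟩ := hex (toCocycle f) h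
    refine ⟨fun a b => (ψ : (Fin 2 → Multiplicative Γ) → Additive Circle)
      ![.ofAdd a, .ofAdd b], ?_⟩
    have h₁ := (d_eq_uncurry₃ ψ).symm.trans ((key ψ).symm.trans
      ((congrArg _ hψ).trans (iCocycles_toCocycle f)))
    funext a b c
    exact congrFun h₁ ![.ofAdd a, .ofAdd b, .ofAdd c]
  · rintro ⟨ψ, hψ⟩
    let ψ' : (Fin 2 → Multiplicative Γ) → coeff Γ := fun g => ψ (g 0).toAdd (g 1).toAdd
    have h₁ : toCocycle f = groupCohomology.toCocycles (coeff Γ) 2 3 ψ' := by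
      apply iCocycles_injective
      rw [iCocycles_toCocycle, key, d_eq_uncurry₃, ← hψ]
      rfl
    have h₂ := (groupCohomology.inhomogeneousCochains (coeff Γ)).toCycles_comp_homologyπ 2 3
    exact (congrArg (groupCohomology.π (coeff Γ) 3) h₁).trans (congrArg (fun φ => φ ψ') h₂)

end Bridge

/-! ### Torsion and divisibility of the circle -/

section CircleTorsion

/-- `exp(2πi/N)`, in the circle group written additively. -/
def zeta (N : ℕ) : Additive Circle := Additive.ofMul (Circle.exp (2 * Real.pi / N))

theorem zsmul_zeta (N : ℕ) [NeZero N] (j : ℤ) :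
    j • zeta N = Additive.ofMul (ZMod.toCircle (j : ZMod N)) := by
  rw [zeta, ← ofMul_zpow, ← Circle.exp_zsmul]
  congr 1
  ext
  rw [ZMod.toCircle_intCast, Circle.coe_exp]
  congr 1
  simp only [zsmul_eq_mul]
  push_cast
  ring

theorem zsmul_zeta_eq_zero_iff (N : ℕ) [NeZero N] (j : ℤ) : j • zeta N = 0 ↔ (N : ℤ) ∣ j := by
  rw [zsmul_zeta, ← ZMod.intCast_zmod_eq_zero_iff_dvd, ofMul_eq_zero]
  constructor
  · intro h
    exact ZMod.injective_toCircle (h.trans (AddChar.map_zero_eq_one _).symm)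
  · intro h
    rw [h, AddChar.map_zero_eq_one]

theorem natCast_smul_zeta_self (N : ℕ) [NeZero N] : (N : ℤ) • zeta N = 0 :=
  (zsmul_zeta_eq_zero_iff N N).2 dvd_rfl

theorem zsmul_zeta_mul (N d : ℕ) [NeZero d] : (d : ℤ) • zeta (N * d) = zeta N := by
  rw [zeta, zeta, ← ofMul_zpow, ← Circle.exp_zsmul]
  have hd : (d : ℝ) ≠ 0 := Nat.cast_ne_zero.2 (NeZero.ne d)
  congr 2
  simp only [zsmul_eq_mul]
  push_cast
  rw [mul_div_assoc', mul_comm (d : ℝ), mul_div_mul_right _ _ hd]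

theorem exists_zsmul_zeta {N : ℕ} [NeZero N] {x : Additive Circle} (hx : (N : ℤ) • x = 0) :
    ∃ c : ℤ, x = c • zeta N := by
  obtain ⟨θ, hθ⟩ := Circle.exp_surjective x.toMul
  have hN : (N : ℝ) ≠ 0 := Nat.cast_ne_zero.2 (NeZero.ne N)
  have h : Circle.exp ((N : ℤ) • θ) = 1 := by
    rw [Circle.exp_zsmul, hθ]
    exact hx
  obtain ⟨c, hc⟩ := Circle.exp_eq_one.1 h
  refine ⟨c, ?_⟩
  rw [zeta, ← ofMul_zpow, ← Circle.exp_zsmul]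
  change x.toMul = Circle.exp _
  rw [← hθ]
  congr 1
  simp only [zsmul_eq_mul] at hc ⊢
  push_cast at hc
  field_simp
  linarith

instance circleDivisible : DivisibleBy (Additive Circle) ℤ :=
  Function.Surjective.divisibleBy Circle.expHom
    (fun x => Circle.exp_surjective x.toMul) fun a k => map_zsmul Circle.expHom k a

end CircleTorsion

/-! ### The carry cocycle ω -/

section Omega

/-- ω is the coboundary of the lift `ZMod.val` divided by N, so its identities follow by cancelling
N. -/
theorem mul_omegaZMod (N : ℕ) [NeZero N] (x y : ZMod N) :
    (N : ℤ) * omegaZMod N x y = (x.val : ℤ) + y.val - (x + y).val := by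
  have h : (x.val : ℤ) / N = 0 := Int.ediv_eq_zero_of_lt (by positivity)
    (by exact_mod_cast ZMod.val_lt x)
  have h' : (y.val : ℤ) / N = 0 := Int.ediv_eq_zero_of_lt (by positivity)
    (by exact_mod_cast ZMod.val_lt y)
  have e : (((x.val : ℤ) : ℚ) + ((y.val : ℤ) : ℚ)) = (((x.val : ℤ) + y.val : ℤ) : ℚ) := by
    push_cast; rfl
  rw [omegaZMod, omega, e, Rat.floor_intCast_div_natCast, Rat.floor_intCast_div_natCast,
    Rat.floor_intCast_div_natCast, h, h', ZMod.val_add]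
  push_cast
  rw [Int.emod_def]
  ring

theorem omegaZMod_comm (N : ℕ) [NeZero N] (x y : ZMod N) :
    omegaZMod N x y = omegaZMod N y x := by
  have hN : (N : ℤ) ≠ 0 := Nat.cast_ne_zero.2 (NeZero.ne N)
  apply mul_left_cancel₀ hN
  rw [mul_omegaZMod, mul_omegaZMod, add_comm x y]
  ring

theorem omegaZMod_zero_left (N : ℕ) [NeZero N] (x : ZMod N) : omegaZMod N 0 x = 0 := by
  have hN : (N : ℤ) ≠ 0 := Nat.cast_ne_zero.2 (NeZero.ne N)
  apply mul_left_cancel₀ hN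
  rw [mul_omegaZMod]
  simp

theorem omegaZMod_zero_right (N : ℕ) [NeZero N] (x : ZMod N) : omegaZMod N x 0 = 0 := by
  rw [omegaZMod_comm, omegaZMod_zero_left]

theorem omegaZMod_cocycle (N : ℕ) [NeZero N] (x y z : ZMod N) :
    d₂ (omegaZMod N) x y z = 0 := by
  have hN : (N : ℤ) ≠ 0 := Nat.cast_ne_zero.2 (NeZero.ne N)
  apply mul_left_cancel₀ hN
  simp only [d₂, mul_add, mul_sub, mul_omegaZMod, add_assoc]
  ring

end Omega

/-! ### The cocycles φ_ij and φ_ijk and their orders -/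

section Phi

variable {m : ℕ} (n : Fin m → ℕ) [∀ i, NeZero (n i)]

/-- The character `a ↦ χ_{nⱼ}(aⱼ)` of `Γ`. -/
def coordChar (j : Fin m) : Gam n →+ Additive Circle :=
  (ZMod.toCircle (N := n j)).toAddMonoidHom.comp (Pi.evalAddMonoidHom _ j)

theorem coordChar_eq (j : Fin m) (a : Gam n) : coordChar n j a = ((a j).val : ℤ) • zeta (n j) := by
  rw [zsmul_zeta, Int.cast_natCast, ZMod.natCast_zmod_val]
  rfl

theorem coordChar_of_eq_zero {j : Fin m} {a : Gam n} (h : a j = 0) : coordChar n j a = 0 := by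
  rw [coordChar_eq, h, ZMod.val_zero]
  simp

theorem coordChar_single (j : Fin m) : coordChar n j (Pi.single j 1) = zeta (n j) := by
  rw [← one_zsmul (zeta (n j)), zsmul_zeta, Int.cast_one]
  change Additive.ofMul (ZMod.toCircle ((Pi.single j 1 : Gam n) j)) = _
  rw [Pi.single_eq_same]

theorem zsmul_coordChar (j : Fin m) (a : Gam n) : (n j : ℤ) • coordChar n j a = 0 := by
  rw [coordChar_eq, smul_comm, natCast_smul_zeta_self, smul_zero]

/-- `φᵢⱼ` with values in the circle group written additively. -/
def Phi₂ (i j : Fin m) (a b c : Gam n) : Additive Circle := Additive.ofMul (phi₂ n i j a b c)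

theorem Phi₂_eq (i j : Fin m) (a b c : Gam n) :
    Phi₂ n i j a b c = omegaZMod (n i) (a i) (b i) • coordChar n j c := by
  change _ = _ • Additive.ofMul (ZMod.toCircle (c j))
  rw [Phi₂, phi₂, ← ofMul_zpow, ← AddChar.map_zsmul_eq_zpow, zsmul_eq_mul]

theorem Phi₂_mem_Z₃ (i j : Fin m) : Phi₂ n i j ∈ Z₃ (Gam n) (Additive Circle) := by
  intro a b c e
  have h := omegaZMod_cocycle (n i) (a i) (b i) (c i)
  have h' : omegaZMod (n i) (a i) (b i) = omegaZMod (n i) (b i) (c i)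
      - omegaZMod (n i) (a i + b i) (c i) + omegaZMod (n i) (a i) (b i + c i) := by
    rw [d₂] at h; linarith
  simp only [d₃, Phi₂_eq, map_add, Pi.add_apply, smul_add]
  rw [h']
  simp only [add_smul, sub_smul]
  abel

theorem zsmul_right_Phi₂ (i j : Fin m) : (n j : ℤ) • Phi₂ n i j = 0 := by
  funext a b c
  change (n j : ℤ) • Phi₂ n i j a b c = 0
  rw [Phi₂_eq, smul_comm, zsmul_coordChar, smul_zero]

/-- The witness is the cup product of the integer lift of a_i, whose coboundary is n_i ω, with the
character of the j-th coordinate. -/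
theorem zsmul_left_Phi₂ (i j : Fin m) : (n i : ℤ) • Phi₂ n i j ∈ B₃ (Gam n) (Additive Circle) := by
  refine ⟨fun a b => ((a i).val : ℤ) • coordChar n j b, ?_⟩
  funext a b c
  change _ = (n i : ℤ) • Phi₂ n i j a b c
  rw [Phi₂_eq, ← mul_smul, mul_omegaZMod]
  simp only [d₂, map_add, Pi.add_apply, smul_add, sub_smul, add_smul]
  module

theorem zsmul_gcd_Phi₂ (i j : Fin m) :
    (gcd₂ n i j : ℤ) • Phi₂ n i j ∈ B₃ (Gam n) (Additive Circle) := by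
  rw [gcd₂, Nat.gcd_eq_gcd_ab, add_smul, mul_comm, mul_smul, mul_comm, mul_smul,
    zsmul_right_Phi₂, smul_zero, add_zero]
  exact AddSubgroup.zsmul_mem _ (zsmul_left_Phi₂ n i j) _

/-- `φᵢⱼₖ` with values in the circle group written additively. -/
def Phi₃ (i j k : Fin m) (a b c : Gam n) : Additive Circle := Additive.ofMul (phi₃ n i j k a b c)

theorem Phi₃_add_left (i j k : Fin m) (a a' b c : Gam n) :
    Phi₃ n i j k (a + a') b c = Phi₃ n i j k a b c + Phi₃ n i j k a' b c := by
  simp only [Phi₃, phi₃, Pi.add_apply, map_add, add_mul, AddChar.map_add_eq_mul, ofMul_mul]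

theorem Phi₃_add_mid (i j k : Fin m) (a b b' c : Gam n) :
    Phi₃ n i j k a (b + b') c = Phi₃ n i j k a b c + Phi₃ n i j k a b' c := by
  simp only [Phi₃, phi₃, Pi.add_apply, map_add, add_mul, mul_add, AddChar.map_add_eq_mul, ofMul_mul]

theorem Phi₃_add_right (i j k : Fin m) (a b c c' : Gam n) :
    Phi₃ n i j k a b (c + c') = Phi₃ n i j k a b c + Phi₃ n i j k a b c' := by
  simp only [Phi₃, phi₃, Pi.add_apply, map_add, mul_add, AddChar.map_add_eq_mul, ofMul_mul]

theorem Phi₃_mem_Z₃ (i j k : Fin m) : Phi₃ n i j k ∈ Z₃ (Gam n) (Additive Circle) := by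
  intro a b c e
  simp only [d₃, Phi₃_add_left, Phi₃_add_mid, Phi₃_add_right]
  abel

theorem Phi₃_of_eq_zero {i j k : Fin m} {a b c : Gam n} (h : a i = 0 ∨ b j = 0 ∨ c k = 0) :
    Phi₃ n i j k a b c = 0 := by
  rcases h with h | h | h <;>
    simp [Phi₃, phi₃, h]

theorem Phi₃_single (i j k : Fin m) :
    Phi₃ n i j k (Pi.single i 1) (Pi.single j 1) (Pi.single k 1) = zeta (gcd₃ n i j k) := by
  rw [← one_zsmul (zeta _), zsmul_zeta]
  simp only [Phi₃, phi₃, Pi.single_eq_same, map_one, mul_one, Int.cast_one]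

theorem zsmul_gcd_Phi₃ (i j k : Fin m) : (gcd₃ n i j k : ℤ) • Phi₃ n i j k = 0 := by
  funext a b c
  change (gcd₃ n i j k : ℤ) • Additive.ofMul (phi₃ n i j k a b c) = 0
  rw [phi₃, ← ofMul_zpow, ← AddChar.map_zsmul_eq_zpow]
  simp

theorem Phi₂_of_eq_zero {i j : Fin m} {a b c : Gam n} (h : a i = 0 ∨ b i = 0 ∨ c j = 0) :
    Phi₂ n i j a b c = 0 := by
  rw [Phi₂_eq]
  rcases h with h | h | h
  · rw [h, omegaZMod_zero_left, zero_smul]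
  · rw [h, omegaZMod_zero_right, zero_smul]
  · rw [coordChar_of_eq_zero n h, smul_zero]

end Phi

/-! ### Invariants vanishing on coboundaries -/

section Invariants

variable {Γ A : Type} [AddCommGroup Γ] [AddCommGroup A]

/-- The alternation of a `3`-cochain. -/
def alt₃ (f : Γ → Γ → Γ → A) (a b c : Γ) : A :=
  f a b c - f a c b + f b c a - f b a c + f c a b - f c b a

theorem alt₃_d₂ (ψ : Γ → Γ → A) (a b c : Γ) : alt₃ (d₂ ψ) a b c = 0 := by
  simp only [alt₃, d₂, add_comm b a, add_comm c a, add_comm c b]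
  abel

/-- The defect of additivity is a signed sum of `d₃ f` over the 12 orderings of a, a', b, c in which
a precedes a'. -/
theorem alt₃_add_left {f : Γ → Γ → Γ → A} (hf : f ∈ Z₃ Γ A) (a a' b c : Γ) :
    alt₃ f (a + a') b c = alt₃ f a b c + alt₃ f a' b c := by
  have key : alt₃ f (a + a') b c - (alt₃ f a b c + alt₃ f a' b c) =
      -d₃ f a a' b c + d₃ f a b a' c - d₃ f a b c a' - d₃ f b a a' c + d₃ f b a c a'
        - d₃ f b c a a' + d₃ f a a' c b - d₃ f a c a' b + d₃ f a c b a' + d₃ f c a a' b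
        - d₃ f c a b a' + d₃ f c b a a' := by
    simp only [d₃, alt₃, add_comm b a, add_comm c a, add_comm c b, add_comm b a', add_comm c a']
    abel
  simp only [mem_Z₃.1 hf] at key
  rw [← sub_eq_zero, key]
  simp

omit [AddCommGroup Γ] in
theorem alt₃_rotate (f : Γ → Γ → Γ → A) (a b c : Γ) : alt₃ f b c a = alt₃ f a b c := by
  simp only [alt₃]
  abel

omit [AddCommGroup Γ] in
theorem alt₃_swap (f : Γ → Γ → Γ → A) (a b c : Γ) : alt₃ f b a c = -alt₃ f a b c := by
  simp only [alt₃]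
  abel

omit [AddCommGroup Γ] in
theorem alt₃_self (f : Γ → Γ → Γ → A) (a b : Γ) : alt₃ f a a b = 0 := by
  simp only [alt₃]
  abel

/-- The sum of `f(g, tg, g)` over `0 ≤ t < L`. -/
def cyclicSum (f : Γ → Γ → Γ → A) (L : ℕ) (g : Γ) : A :=
  ∑ t ∈ Finset.range L, f g (t • g) g

/-- The sum telescopes in ψ(g, tg) - ψ(tg, g), and the ends agree because Lg = 0. -/
theorem cyclicSum_d₂ (ψ : Γ → Γ → A) {L : ℕ} {g : Γ} (hg : L • g = 0) :
    cyclicSum (d₂ ψ) L g = 0 := by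
  have h : ∀ t : ℕ, d₂ ψ g (t • g) g =
      (ψ g ((t + 1) • g) - ψ ((t + 1) • g) g) - (ψ g (t • g) - ψ (t • g) g) := by
    intro t
    rw [d₂, succ_nsmul, add_comm g]
    abel
  rw [cyclicSum, Finset.sum_congr rfl fun t _ => h t,
    Finset.sum_range_sub (fun t => ψ g (t • g) - ψ (t • g) g), hg, zero_smul]
  abel

end Invariants

/-! ### Symmetric 2-cocycles and abelian extensions -/

section Symmetric

variable {Γ A : Type} [AddCommGroup Γ] [AddCommGroup A]

/-- The underlying type `A × Γ` of the extension of `Γ` by `A` defined by a symmetric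
`2`-cocycle. -/
@[ext]
structure Extension (g : Γ → Γ → A) where
  /-- The component in the kernel. -/
  fst : A
  /-- The component in the quotient. -/
  snd : Γ

instance (g : Γ → Γ → A) : Add (Extension g) := ⟨fun p q => ⟨p.1 + q.1 + g p.2 q.2, p.2 + q.2⟩⟩

/-- The cocycle g is not assumed normalized, hence the shift by g(0, 0). -/
instance (g : Γ → Γ → A) : Zero (Extension g) := ⟨⟨-g 0 0, 0⟩⟩

instance (g : Γ → Γ → A) : Neg (Extension g) := ⟨fun p => ⟨-p.1 - g p.2 (-p.2) - g 0 0, -p.2⟩⟩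

theorem apply_zero_left_of_d₂_eq_zero {g : Γ → Γ → A} (hg : ∀ a b c, d₂ g a b c = 0) (x : Γ) :
    g 0 x = g 0 0 := by
  have := hg 0 0 x
  simp only [d₂, zero_add, sub_self] at this
  exact sub_eq_zero.1 this

/-- The commutative group structure on the extension defined by a symmetric `2`-cocycle. -/
abbrev extensionGroup {g : Γ → Γ → A} (hg : ∀ a b c, d₂ g a b c = 0) (hs : ∀ a b, g a b = g b a) :
    AddCommGroup (Extension g) :=
  { AddGroup.ofLeftAxioms (G := Extension g)
      (fun p q r => by
        apply Extension.ext
        · change p.1 + q.1 + g p.2 q.2 + r.1 + g (p.2 + q.2) r.2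
            = p.1 + (q.1 + r.1 + g q.2 r.2) + g p.2 (q.2 + r.2)
          have h := hg p.2 q.2 r.2
          rw [← sub_eq_zero, ← neg_eq_zero, ← h, d₂]
          abel
        · exact add_assoc _ _ _)
      (fun p => by
        apply Extension.ext
        · change -g 0 0 + p.1 + g 0 p.2 = p.1
          rw [apply_zero_left_of_d₂_eq_zero hg p.2]
          abel
        · exact zero_add _)
      (fun p => by
        apply Extension.ext
        · change -p.1 - g p.2 (-p.2) - g 0 0 + p.1 + g (-p.2) p.2 = -g 0 0
          rw [hs (-p.2)]
          abel
        · exact neg_add_cancel _) with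
    add_comm := fun p q => by
      apply Extension.ext
      · change p.1 + q.1 + g p.2 q.2 = q.1 + p.1 + g q.2 p.2
        rw [hs, add_comm p.1]
      · exact add_comm _ _ }

/-- A symmetric `2`-cocycle with values in a divisible group is a coboundary. -/
theorem exists_of_symmetric [DivisibleBy A ℤ] {g : Γ → Γ → A} (hg : ∀ a b c, d₂ g a b c = 0)
    (hs : ∀ a b, g a b = g b a) : ∃ ε : Γ → A, ∀ a b, g a b = ε a + ε b - ε (a + b) := by
  let _ := extensionGroup hg hs
  have hadd : ∀ p q : Extension g, p + q = ⟨p.1 + q.1 + g p.2 q.2, p.2 + q.2⟩ := fun _ _ => rfl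
  let ι : A →+ Extension g := AddMonoidHom.mk' (fun a => ⟨a - g 0 0, 0⟩) fun a b => by
    rw [hadd]
    apply Extension.ext
    · change a + b - g 0 0 = a - g 0 0 + (b - g 0 0) + g 0 0
      abel
    · exact (add_zero _).symm
  have hι : Function.Injective ι := fun a b h => sub_left_injective (congrArg Extension.fst h)
  -- A divisible group is injective, so the extension has a retraction r onto A; ε is r along the
  -- set-theoretic section x ↦ (0, x).
  obtain ⟨r, hr⟩ := (Module.Baer.of_divisible A).extension_property_addMonoidHom ι hι
    (AddMonoidHom.id A)
  have hr' : ∀ a, r (ι a) = a := fun a => DFunLike.congr_fun hr a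
  refine ⟨fun x => r ⟨0, x⟩, fun a b => ?_⟩
  have h₁ : (⟨0, a⟩ : Extension g) + ⟨0, b⟩ = ι (g a b) + ⟨0, a + b⟩ := by
    rw [hadd, hadd]
    apply Extension.ext
    · change 0 + 0 + g a b = g a b - g 0 0 + 0 + g 0 (a + b)
      rw [apply_zero_left_of_d₂_eq_zero hg (a + b)]
      abel
    · exact (zero_add _).symm
  have h₂ := congrArg r h₁
  rw [map_add, map_add, hr'] at h₂
  rw [h₂]
  abel

end Symmetric

/-! ### Homogeneous cochains and prism homotopies -/

section Homogeneous

variable {Γ A : Type} [AddCommGroup Γ] [AddCommGroup A]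

/-- The coboundary of a homogeneous `1`-cochain. -/
def dHom₁ (E : Γ → Γ → A) (x y z : Γ) : A := E y z - E x z + E x y

/-- The coboundary of a homogeneous `2`-cochain. -/
def dHom₂ (F : Γ → Γ → Γ → A) (x y z w : Γ) : A := F y z w - F x z w + F x y w - F x y z

omit [AddCommGroup Γ] in
theorem dHom₂_dHom₁ (E : Γ → Γ → A) (x y z w : Γ) : dHom₂ (dHom₁ E) x y z w = 0 := by
  simp only [dHom₂, dHom₁]
  abel

/-- The group of periods of a function of three variables under simultaneous translation. -/
def periods (K : Γ → Γ → Γ → A) : AddSubgroup Γ where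
  carrier := {g | ∀ x y z, K (g + x) (g + y) (g + z) = K x y z}
  zero_mem' x y z := by simp only [zero_add]
  add_mem' {g h} hg hh x y z := by rw [add_assoc, add_assoc, add_assoc, hg, hh]
  neg_mem' {g} hg x y z := by
    rw [← hg, add_neg_cancel_left, add_neg_cancel_left, add_neg_cancel_left]

/-- Translation by p a moves the base point of the first term of the coboundary from 0 to p a. -/
theorem d₂_of_periods {K : Γ → Γ → Γ → A} {p : Γ →+ Γ} (hK : ∀ a, p a ∈ periods K) (a b c : Γ) :
    d₂ (fun a b => K 0 (p a) (p a + p b)) a b c =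
      dHom₂ K 0 (p a) (p a + p b) (p a + p b + p c) := by
  have h := hK a 0 (p b) (p b + p c)
  rw [add_zero] at h
  simp only [d₂, dHom₂, add_assoc, h, map_add]

/-- The prism homotopy in degree `2`. -/
def prism₂ (p : Γ → Γ) (K : Γ → Γ → Γ → A) (x y : Γ) : A := K x y (p y) - K x (p x) (p y)

-- The prism between (x, y, z) and its image under p is cut into three 3-simplices, on each of which
-- K is closed.
omit [AddCommGroup Γ] in
theorem dHom₁_prism₂ (p : Γ → Γ) {K : Γ → Γ → Γ → A} (hK : ∀ x y z w, dHom₂ K x y z w = 0)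
    (x y z : Γ) : dHom₁ (prism₂ p K) x y z = K x y z - K (p x) (p y) (p z) := by
  have key : dHom₁ (prism₂ p K) x y z - (K x y z - K (p x) (p y) (p z)) =
      dHom₂ K x (p x) (p y) (p z) - dHom₂ K x y (p y) (p z) + dHom₂ K x y z (p z) := by
    simp only [dHom₁, dHom₂, prism₂]
    abel
  rw [← sub_eq_zero, key]
  simp [hK]

/-- The prism homotopy in degree `3`, applied to the homogeneous cochain attached to `f`. -/
def prism₃ (p : Γ → Γ) (f : Γ → Γ → Γ → A) (x y z : Γ) : A :=
  f (y - x) (p y - y) (p z - p y) - f (p x - x) (p y - p x) (p z - p y)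
    - f (y - x) (z - y) (p z - z)

/-- One degree higher: the cocycle identity on the four 4-simplices of the prism over (x, y, z, w).
-/
theorem dHom₂_prism₃ (p : Γ → Γ) {f : Γ → Γ → Γ → A} (hf : f ∈ Z₃ Γ A) (x y z w : Γ) :
    dHom₂ (prism₃ p f) x y z w =
      f (y - x) (z - y) (w - z) - f (p y - p x) (p z - p y) (p w - p z) := by
  have h : ∀ x y z w v : Γ, f (z - y) (w - z) (v - w) - f (z - x) (w - z) (v - w)
      + f (y - x) (w - y) (v - w) - f (y - x) (z - y) (v - z) + f (y - x) (z - y) (w - z) = 0 := by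
    intro x y z w v
    have := hf (y - x) (z - y) (w - z) (v - w)
    rw [d₃] at this
    rw [← this]
    congr <;> abel
  have h₁ := h x (p x) (p y) (p z) (p w)
  have h₂ := h x y (p y) (p z) (p w)
  have h₃ := h x y z (p z) (p w)
  have h₄ := h x y z w (p w)
  rw [← sub_eq_zero]
  have key := congrArg₂ (· - ·) (congrArg₂ (· - ·) h₂ h₁) (congrArg₂ (· - ·) h₃ h₄)
  simp only [sub_zero] at key
  rw [← neg_eq_zero, ← key]
  simp only [dHom₂, prism₃]
  abel

end Homogeneous

/-! ### Descent along a cyclic quotient -/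

section Cyclic

variable {Γ A : Type} [AddCommGroup Γ] [AddCommGroup A] {N : ℕ}

/-- `F` trivializes `f` over the kernel of `c`, `E` trivializes the difference of `F` and its
translate by `e`, and the norm of `E` is the homomorphism `χ`. -/
structure Descent (c : Γ →+ ZMod N) (e : Γ) (f : Γ → Γ → Γ → A) (χ : Γ →+ A)
    (F : Γ → Γ → Γ → A) (E : Γ → Γ → A) : Prop where
  inv_F : ∀ g, c g = 0 → ∀ x y z, F (g + x) (g + y) (g + z) = F x y z
  dHom_F : ∀ x y z w, dHom₂ F x y z w = f (y - x) (z - y) (w - z)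
  inv_E : ∀ g, c g = 0 → ∀ x y, E (g + x) (g + y) = E x y
  dHom_E : ∀ x y z, dHom₁ E x y z = F (x - e) (y - e) (z - e) - F x y z
  norm_E : ∀ x y, ∑ t ∈ Finset.range N, E (x - t • e) (y - t • e) = χ (y - x)

/-- The pairs `(f, χ)` occurring in descent data. -/
def descentGroup (A : Type) [AddCommGroup A] (c : Γ →+ ZMod N) (e : Γ) :
    AddSubgroup ((Γ → Γ → Γ → A) × (Γ →+ A)) where
  carrier := {p | ∃ F E, Descent c e p.1 p.2 F E}
  zero_mem' := ⟨0, 0, by constructor <;> intros <;> simp [dHom₁, dHom₂]⟩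
  add_mem' := by
    rintro ⟨f, χ⟩ ⟨f', χ'⟩ ⟨F, E, h⟩ ⟨F', E', h'⟩
    refine ⟨F + F', E + E', ?_, ?_, ?_, ?_, ?_⟩
    · intro g hg x y z
      simp only [Pi.add_apply, h.inv_F g hg, h'.inv_F g hg]
    · intro x y z w
      have e₁ := h.dHom_F x y z w
      have e₂ := h'.dHom_F x y z w
      simp only [Pi.add_apply, Prod.mk_add_mk] at e₁ e₂ ⊢
      rw [← e₁, ← e₂]
      simp only [dHom₂, Pi.add_apply]
      abel
    · intro g hg x y
      simp only [Pi.add_apply, h.inv_E g hg, h'.inv_E g hg]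
    · intro x y z
      simp only [Pi.add_apply]
      rw [add_sub_add_comm, ← h.dHom_E, ← h'.dHom_E]
      simp only [dHom₁, Pi.add_apply]
      abel
    · intro x y
      simp only [Pi.add_apply, Prod.mk_add_mk, AddMonoidHom.add_apply, Finset.sum_add_distrib,
        h.norm_E, h'.norm_E]
  neg_mem' := by
    rintro ⟨f, χ⟩ ⟨F, E, h⟩
    refine ⟨-F, -E, ?_, ?_, ?_, ?_, ?_⟩
    · intro g hg x y z
      simp only [Pi.neg_apply, h.inv_F g hg]
    · intro x y z w
      have e₁ := h.dHom_F x y z w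
      simp only [Pi.neg_apply, Prod.neg_mk] at e₁ ⊢
      rw [← e₁]
      simp only [dHom₂, Pi.neg_apply]
      abel
    · intro g hg x y
      simp only [Pi.neg_apply, h.inv_E g hg]
    · intro x y z
      simp only [Pi.neg_apply]
      rw [← neg_sub', ← h.dHom_E]
      simp only [dHom₁, Pi.neg_apply]
      abel
    · intro x y
      simp only [Pi.neg_apply, Prod.neg_mk, AddMonoidHom.neg_apply, Finset.sum_neg_distrib,
        h.norm_E]

theorem mem_of_ker_of_mem [NeZero N] {c : Γ →+ ZMod N} {e : Γ} (hce : c e = 1) {S : AddSubgroup Γ}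
    (hker : ∀ g, c g = 0 → g ∈ S) (he : e ∈ S) (y : Γ) : y ∈ S := by
  have h : y - (c y).val • e ∈ S := hker _ (by
    rw [map_sub, map_nsmul, hce, nsmul_one, ZMod.natCast_zmod_val, sub_self])
  simpa using S.add_mem h (S.nsmul_mem he (c y).val)

theorem val_sub_one_cases [NeZero N] (x : ZMod N) :
    (x.val = (x - 1).val + 1) ∨ (x.val = 0 ∧ (x - 1).val + 1 = N) := by
  obtain ⟨y, rfl⟩ : ∃ y, x = y + 1 := ⟨x - 1, by ring⟩
  rw [add_sub_cancel_right, ZMod.val_add, ZMod.val_one_eq_one_mod, Nat.add_mod_mod]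
  rcases (Nat.succ_le_of_lt (ZMod.val_lt y)).lt_or_eq with h | h
  · exact Or.inl (Nat.mod_eq_of_lt h)
  · refine Or.inr ⟨?_, h⟩
    rw [← Nat.succ_eq_add_one, h, Nat.mod_self]

/-- A `1`-cochain of norm zero is a difference of translates. -/
theorem exists_translate_sub [NeZero N] {c : Γ →+ ZMod N} {e : Γ} (hce : c e = 1) {E : Γ → Γ → A}
    (hinv : ∀ g, c g = 0 → ∀ x y, E (g + x) (g + y) = E x y)
    (hnorm : ∀ x y, ∑ t ∈ Finset.range N, E (x - t • e) (y - t • e) = 0) :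
    ∃ E' : Γ → Γ → A, (∀ g, c g = 0 → ∀ x y, E' (g + x) (g + y) = E' x y) ∧
      ∀ x y, E' (x - e) (y - e) - E' x y = E x y := by
  -- A partial norm whose length is the lift of c x. Translation by -e shortens it by one, except
  -- that length 0 wraps to N - 1, where the vanishing of the full norm is needed.
  refine ⟨fun x y => -∑ t ∈ Finset.range (c x).val, E (x - t • e) (y - t • e), ?_, ?_⟩
  · intro g hg x y
    simp only [map_add, hg, zero_add, add_sub_assoc, hinv g hg]
  · intro x y
    have hs : ∀ L : ℕ, ∑ t ∈ Finset.range (L + 1), E (x - t • e) (y - t • e) =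
        ∑ t ∈ Finset.range L, E (x - e - t • e) (y - e - t • e) + E x y := by
      intro L
      rw [Finset.sum_range_succ']
      simp only [succ_nsmul', zero_smul, sub_zero, sub_sub]
    simp only [map_sub, hce]
    rcases val_sub_one_cases (c x) with h | ⟨h, h'⟩
    · rw [h, hs]
      abel
    · have := hnorm x y
      rw [← h', hs] at this
      rw [h, Finset.sum_range_zero, eq_neg_of_add_eq_zero_left this]
      abel

/-- Norm zero makes E the change of some E' under translation. Then F - dE' has the same coboundary
as F and is invariant under both the kernel and e, hence under Γ, so it descends to an inhomogeneous
cochain. -/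
theorem mem_B₃_of_descent [NeZero N] {c : Γ →+ ZMod N} {e : Γ} (hce : c e = 1)
    {f : Γ → Γ → Γ → A} (h : (f, 0) ∈ descentGroup A c e) : f ∈ B₃ Γ A := by
  obtain ⟨F, E, h⟩ := h
  obtain ⟨E', hinv, hE'⟩ := exists_translate_sub hce h.inv_E h.norm_E
  let K : Γ → Γ → Γ → A := fun x y z => F x y z - dHom₁ E' x y z
  have hK : ∀ y, y ∈ periods K := by
    refine mem_of_ker_of_mem hce (fun g hg x y z => ?_) ?_
    · simp only [K, dHom₁, h.inv_F g hg, hinv g hg]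
    · refine (neg_mem_iff (S := AddSubgroup Γ)).1 fun x y z => ?_
      have h₁ := h.dHom_E x y z
      simp only [dHom₁, ← hE'] at h₁
      rw [← sub_eq_zero]
      simp only [neg_add_eq_sub, K, dHom₁]
      rw [← sub_eq_zero.2 h₁.symm]
      abel
  refine ⟨fun a b => K 0 a (a + b), ?_⟩
  funext a b d
  refine (d₂_of_periods (p := AddMonoidHom.id Γ) hK a b d).trans ?_
  have h₁ := dHom₂_dHom₁ E' 0 a (a + b) (a + b + d)
  have h₂ := h.dHom_F 0 a (a + b) (a + b + d)
  simp only [sub_zero, add_sub_cancel_left] at h₂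
  rw [← h₂, ← sub_zero (dHom₂ F _ _ _ _), ← h₁]
  simp only [dHom₂, K, AddMonoidHom.id_apply]
  abel

theorem exists_descent [DivisibleBy A ℤ] [NeZero N] {c : Γ →+ ZMod N} {e : Γ} (hce : c e = 1)
    (hNe : N • e = 0) {p : Γ →+ Γ} (hpc : ∀ x, c (p x) = 0) (hp : ∀ g, c g = 0 → p g = g)
    (hpe : p e = 0) {f : Γ → Γ → Γ → A} (hf : f ∈ Z₃ Γ A)
    (hfp : ∀ x y z, f (p x) (p y) (p z) = 0) (halt : ∀ x y, alt₃ f e (p x) (p y) = 0) :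
    ∃ χ : Γ →+ A, (f, χ) ∈ descentGroup A c e := by
  -- As f vanishes on the image of p, the prism homotopy from the identity to p trivializes f.
  set F := prism₃ p f with hF
  have inv_F : ∀ g, c g = 0 → ∀ x y z, F (g + x) (g + y) (g + z) = F x y z := by
    intro g hg x y z
    simp only [hF, prism₃, map_add, hp g hg, add_sub_add_left_eq_sub]
  have dHom_F : ∀ x y z w, dHom₂ F x y z w = f (y - x) (z - y) (w - z) := by
    intro x y z w
    rw [hF, dHom₂_prism₃ _ hf, ← map_sub, ← map_sub, ← map_sub, hfp, sub_zero]
  let F' : Γ → Γ → Γ → A := fun x y z => F (x - e) (y - e) (z - e) - F x y z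
  have hF'p : ∀ a, p a ∈ periods F' := by
    intro a x y z
    simp only [F', add_sub_assoc, inv_F _ (hpc a)]
  have hdF' : ∀ x y z w, dHom₂ F' x y z w = 0 := by
    intro x y z w
    have h₁ := dHom_F (x - e) (y - e) (z - e) (w - e)
    simp only [sub_sub_sub_cancel_right] at h₁
    rw [← sub_eq_zero.2 (h₁.trans (dHom_F x y z w).symm)]
    simp only [dHom₂, F']
    abel
  have hpp : ∀ x, p (p x) = p x := fun x => hp _ (hpc x)
  -- Up to sign this is the slant product of f with e; its antisymmetrization is the alternation of
  -- f at e, so `halt` makes it symmetric.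
  have hg : ∀ a b, F' 0 (p a) (p a + p b) =
      -(f e (p a) (p b) - f (p a) e (p b) + f (p a) (p b) e) := by
    intro a b
    have h₁ := hfp 0 a b
    have h₂ := hfp a 0 b
    have h₃ := hfp a b 0
    simp only [map_zero] at h₁ h₂ h₃
    simp only [F', hF, prism₃, map_add, map_sub, map_zero, hpp, hpe, sub_zero, zero_sub, sub_neg_eq_add,
      sub_self, sub_sub_cancel, add_sub_cancel_left, zero_add, sub_sub_sub_cancel_right, h₁, h₂, h₃]
    abel
  obtain ⟨ε, hε⟩ := exists_of_symmetric (g := fun a b => F' 0 (p a) (p a + p b))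
    (fun a b d => (d₂_of_periods hF'p a b d).trans (hdF' _ _ _ _)) (fun a b => by
      have := halt a b
      simp only [hg]
      rw [alt₃] at this
      rw [← sub_eq_zero, ← neg_eq_zero, ← this]
      abel)
  -- The prism term reduces F' to its values on the image of p, where ε trivializes it.
  let E : Γ → Γ → A := fun x y => ε (y - x) + prism₂ p F' x y
  have inv_E : ∀ g, c g = 0 → ∀ x y, E (g + x) (g + y) = E x y := by
    intro g hg x y
    have hF'g : ∀ x y z, F' (g + x) (g + y) (g + z) = F' x y z := by
      have := hF'p g
      rwa [hp g hg] at this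
    simp only [E, prism₂, map_add, hp g hg, hF'g, add_sub_add_left_eq_sub]
  have dHom_E : ∀ x y z, dHom₁ E x y z = F' x y z := by
    intro x y z
    have h₁ := dHom₁_prism₂ p hdF' x y z
    have h₂ := hF'p x 0 (p (y - x)) (p (y - x) + p (z - y))
    have h₃ := hε (y - x) (z - y)
    rw [← h₂, ← add_assoc, ← map_add, ← map_add, add_zero, add_sub_cancel, add_sub_cancel,
      add_comm (y - x), sub_add_sub_cancel] at h₃
    rw [← sub_add_cancel (F' x y z) (F' (p x) (p y) (p z)), ← h₁, h₃]
    simp only [dHom₁, E]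
    abel
  -- The norm of E is invariant under Γ, and its coboundary telescopes to 0 because Ne = 0; such a
  -- function is a homomorphism in y - x.
  let X : Γ → Γ → A := fun x y => ∑ t ∈ Finset.range N, E (x - t • e) (y - t • e)
  have hX : ∀ g, g ∈ periods (fun x y _ => X x y) := by
    refine mem_of_ker_of_mem hce (fun g hg x y z => ?_) ?_
    · simp only [X, add_sub_assoc, inv_E g hg]
    · refine (neg_mem_iff (S := AddSubgroup Γ)).1 fun x y z => ?_
      have h₁ := Finset.sum_range_succ' (fun t : ℕ => E (x - t • e) (y - t • e)) N
      rw [Finset.sum_range_succ, hNe, zero_smul] at h₁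
      simp only [X, neg_add_eq_sub]
      rw [add_right_cancel h₁]
      simp only [succ_nsmul', sub_sub]
  have hdX : ∀ x y z, dHom₁ X x y z = 0 := by
    intro x y z
    have h₁ : dHom₁ X x y z = ∑ t ∈ Finset.range N,
        dHom₁ E (x - t • e) (y - t • e) (z - t • e) := by
      simp only [dHom₁, X, Finset.sum_add_distrib, Finset.sum_sub_distrib]
    have h₂ : ∀ t : ℕ, dHom₁ E (x - t • e) (y - t • e) (z - t • e) =
        F (x - (t + 1) • e) (y - (t + 1) • e) (z - (t + 1) • e)
          - F (x - t • e) (y - t • e) (z - t • e) := by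
      intro t
      rw [dHom_E]
      simp only [F', succ_nsmul, sub_sub]
    rw [h₁, Finset.sum_congr rfl fun t _ => h₂ t,
      Finset.sum_range_sub (fun t => F (x - t • e) (y - t • e) (z - t • e)), hNe, zero_smul,
      sub_self]
  let χ : Γ →+ A := AddMonoidHom.mk' (fun a => X 0 a) fun a b => by
    have h₁ := hdX 0 a (a + b)
    have h₂ := hX a 0 b 0
    simp only [add_zero] at h₂
    rw [dHom₁, h₂] at h₁
    rw [← sub_eq_zero, ← neg_eq_zero, ← h₁]
    abel
  refine ⟨χ, F, E, inv_F, dHom_F, inv_E, dHom_E, fun x y => ?_⟩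
  have := hX x 0 (y - x) 0
  simp only [add_zero, add_sub_cancel] at this
  exact this

end Cyclic

/-! ### Pullback along endomorphisms -/

section Pull

variable {Γ A : Type} [AddCommGroup Γ] [AddCommGroup A]

/-- The pullback of `3`-cochains along an endomorphism. -/
def pull (p : Γ →+ Γ) : (Γ → Γ → Γ → A) →+ (Γ → Γ → Γ → A) where
  toFun f a b c := f (p a) (p b) (p c)
  map_zero' := rfl
  map_add' _ _ := rfl

theorem pull_apply (p : Γ →+ Γ) (f : Γ → Γ → Γ → A) (a b c : Γ) :
    pull p f a b c = f (p a) (p b) (p c) := rfl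

theorem pull_pull (p q : Γ →+ Γ) (f : Γ → Γ → Γ → A) : pull p (pull q f) = pull (q.comp p) f := rfl

theorem pull_mem_Z₃ (p : Γ →+ Γ) {f : Γ → Γ → Γ → A} (hf : f ∈ Z₃ Γ A) : pull p f ∈ Z₃ Γ A := by
  intro a b c e
  have := hf (p a) (p b) (p c) (p e)
  simpa only [d₃, pull_apply, map_add] using this

theorem pull_mem_B₃ (p : Γ →+ Γ) {f : Γ → Γ → Γ → A} (hf : f ∈ B₃ Γ A) : pull p f ∈ B₃ Γ A := by
  obtain ⟨ψ, rfl⟩ := hf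
  refine ⟨fun a b => ψ (p a) (p b), ?_⟩
  funext a b c
  simp only [d₂, pull_apply, map_add]

/-- The alternation, as a homomorphism in the cochain. -/
def altHom (a b c : Γ) : (Γ → Γ → Γ → A) →+ A :=
  AddMonoidHom.mk' (fun f => alt₃ f a b c) fun f g => by
    simp only [alt₃, Pi.add_apply]
    abel

omit [AddCommGroup Γ] in
theorem altHom_apply (a b c : Γ) (f : Γ → Γ → Γ → A) : altHom a b c f = alt₃ f a b c := rfl

/-- The alternation of a `3`-cocycle, as a homomorphism in the first variable. -/
def altLeft {f : Γ → Γ → Γ → A} (hf : f ∈ Z₃ Γ A) (b c : Γ) : Γ →+ A :=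
  AddMonoidHom.mk' (fun a => alt₃ f a b c) fun a a' => alt₃_add_left hf a a' b c

end Pull

/-! ### Coordinate projections and explicit descent data -/

section Coordinates

variable {m : ℕ} (n : Fin m → ℕ)

/-- The endomorphism of `Γ` keeping the coordinates in a set and replacing the others by `0`. -/
def keep (P : Set (Fin m)) : Gam n →+ Gam n :=
  open Classical in
  AddMonoidHom.mk' (fun a i => if i ∈ P then a i else 0) fun a b => by
    funext i
    by_cases h : i ∈ P <;> simp [h]

variable {n}

theorem keep_of_mem {P : Set (Fin m)} {i : Fin m} (h : i ∈ P) (a : Gam n) :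
    keep n P a i = a i := if_pos h

theorem keep_of_notMem {P : Set (Fin m)} {i : Fin m} (h : i ∉ P) (a : Gam n) :
    keep n P a i = 0 := if_neg h

theorem keep_keep (P Q : Set (Fin m)) : (keep n P).comp (keep n Q) = keep n (P ∩ Q) := by
  refine AddMonoidHom.ext fun a => funext fun i => ?_
  change keep n P (keep n Q a) i = _
  by_cases hP : i ∈ P
  · by_cases hQ : i ∈ Q
    · rw [keep_of_mem hP, keep_of_mem hQ, keep_of_mem (Set.mem_inter hP hQ)]
    · rw [keep_of_mem hP, keep_of_notMem hQ, keep_of_notMem fun h => hQ h.2]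
  · rw [keep_of_notMem hP, keep_of_notMem fun h => hP h.1]

theorem keep_univ : keep n Set.univ = AddMonoidHom.id (Gam n) := by
  refine AddMonoidHom.ext fun a => funext fun i => ?_
  exact keep_of_mem (Set.mem_univ i) a

theorem keep_single_of_notMem {P : Set (Fin m)} {i : Fin m} (h : i ∉ P) (x : ZMod (n i)) :
    keep n P (Pi.single i x) = 0 := by
  funext j
  by_cases hj : j ∈ P
  · rw [keep_of_mem hj, Pi.single_eq_of_ne (fun h' => h (by rwa [← h']))]
    rfl
  · exact keep_of_notMem hj _

theorem nsmul_single (i : Fin m) : n i • (Pi.single i 1 : Gam n) = 0 := by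
  rw [← Pi.single_smul, nsmul_one, ZMod.natCast_self, Pi.single_zero]

variable [∀ i, NeZero (n i)]

theorem pull_keep_Phi₂ {P : Set (Fin m)} {i j : Fin m} (hi : i ∈ P) (hj : j ∈ P) :
    pull (keep n P) (Phi₂ n i j) = Phi₂ n i j := by
  funext a b c
  simp only [pull_apply, Phi₂_eq, keep_of_mem hi, coordChar_eq, keep_of_mem hj]

theorem pull_keep_Phi₂_eq_zero {P : Set (Fin m)} {i j : Fin m} (h : i ∉ P ∨ j ∉ P) :
    pull (keep n P) (Phi₂ n i j) = 0 := by
  funext a b c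
  rcases h with h | h
  · exact Phi₂_of_eq_zero n (Or.inl (keep_of_notMem h a))
  · exact Phi₂_of_eq_zero n (Or.inr (Or.inr (keep_of_notMem h c)))

theorem pull_keep_Phi₃ {P : Set (Fin m)} {i j k : Fin m} (hi : i ∈ P) (hj : j ∈ P) (hk : k ∈ P) :
    pull (keep n P) (Phi₃ n i j k) = Phi₃ n i j k := by
  funext a b c
  simp only [pull_apply, Phi₃, phi₃, keep_of_mem hi, keep_of_mem hj, keep_of_mem hk]

theorem pull_keep_Phi₃_eq_zero {P : Set (Fin m)} {i j k : Fin m} (h : k ∉ P) :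
    pull (keep n P) (Phi₃ n i j k) = 0 := by
  funext a b c
  exact Phi₃_of_eq_zero n (Or.inr (Or.inr (keep_of_notMem h c)))

theorem hom_apply_eq_sum {A : Type} [AddCommGroup A] (χ : Gam n →+ A) (a : Gam n) :
    χ a = ∑ i, (a i).val • χ (Pi.single i 1) := by
  conv_lhs => rw [← Finset.univ_sum_single a, map_sum]
  refine Finset.sum_congr rfl fun i _ => ?_
  rw [← map_nsmul, ← Pi.single_smul, nsmul_one, ZMod.natCast_zmod_val]

theorem hom_eq_zero {A : Type} [AddCommGroup A] {χ : Gam n →+ A} (h : ∀ i, χ (Pi.single i 1) = 0)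
    (a : Gam n) : χ a = 0 := by
  rw [hom_apply_eq_sum]
  exact Finset.sum_eq_zero fun i _ => by rw [h, smul_zero]

theorem exists_sum_coordChar (χ : Gam n →+ Additive Circle) :
    ∃ s : Fin m → ℤ, χ = ∑ i, s i • coordChar n i := by
  have h : ∀ i, ∃ s : ℤ, χ (Pi.single i 1) = s • zeta (n i) := fun i =>
    exists_zsmul_zeta (by rw [natCast_zsmul, ← map_nsmul, nsmul_single, map_zero])
  choose s hs using h
  refine ⟨s, AddMonoidHom.ext fun a => ?_⟩
  rw [hom_apply_eq_sum, AddMonoidHom.finsetSum_apply]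
  refine Finset.sum_congr rfl fun i _ => ?_
  rw [hs, AddMonoidHom.smul_apply, coordChar_eq, natCast_zsmul, smul_comm]

/-- Here F evaluates the character at the endpoint z, so translation by e_k changes F by -ω times
the n_k-th root of unity. Since n_i ω is the coboundary of the lift, E is built from an (n_i n_k)-th
root of unity, and summing n_k copies leaves an n_i-th root. -/
theorem Phi₂_mem_descentGroup (i k : Fin m) : (Phi₂ n i k, -coordChar n i) ∈
    descentGroup (Additive Circle) (Pi.evalAddMonoidHom (fun i => ZMod (n i)) k)
      (Pi.single k 1) := by
  refine ⟨fun x y z => omegaZMod (n i) ((y - x) i) ((z - y) i) • coordChar n k z,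
    fun x y => -(((y - x) i).val • zeta (n i * n k)), ?_, ?_, ?_, ?_, ?_⟩
  · intro g hg x y z
    simp only [add_sub_add_left_eq_sub, map_add, coordChar_of_eq_zero n (show g k = 0 from hg),
      zero_add]
  · intro x y z w
    have h := omegaZMod_cocycle (n i) ((y - x) i) ((z - y) i) ((w - z) i)
    rw [d₂, ← Pi.add_apply, ← Pi.add_apply, add_comm (y - x), sub_add_sub_cancel, add_comm (z - y),
      sub_add_sub_cancel] at h
    simp only [dHom₂]
    rw [Phi₂_eq, map_sub, ← sub_eq_zero, ← zero_smul ℤ (coordChar n k w), ← h]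
    module
  · intro g hg x y
    simp only [add_sub_add_left_eq_sub]
  · intro x y z
    have h := mul_omegaZMod (n i) ((y - x) i) ((z - y) i)
    rw [← Pi.add_apply, add_comm (y - x), sub_add_sub_cancel] at h
    simp only [dHom₁, sub_sub_sub_cancel_right, map_sub, coordChar_single]
    rw [← smul_sub, sub_sub_cancel_left, smul_neg, ← zsmul_zeta_mul (n k) (n i), ← mul_smul,
      mul_comm _ (n i : ℤ), h, mul_comm (n k)]
    simp only [← natCast_zsmul]
    module
  · intro x y
    simp only [sub_sub_sub_cancel_right, Finset.sum_const, Finset.card_range, AddMonoidHom.neg_apply]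
    rw [coordChar_eq, smul_neg, smul_comm, ← zsmul_zeta_mul (n i) (n k), natCast_zsmul,
      natCast_zsmul]

theorem alt₃_single_eq_zero {f : Gam n → Gam n → Gam n → Additive Circle}
    (hf : f ∈ Z₃ (Gam n) (Additive Circle)) {k : Fin m}
    (h : ∀ i j, alt₃ f (Pi.single k 1) (Pi.single i 1) (Pi.single j 1) = 0) (x y : Gam n) :
    alt₃ f (Pi.single k 1) x y = 0 := by
  rw [alt₃_rotate f y]
  refine hom_eq_zero (χ := altLeft hf (Pi.single k 1) x) (fun j => ?_) y
  change alt₃ f (Pi.single j 1) (Pi.single k 1) x = 0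
  rw [← alt₃_rotate, ← alt₃_rotate]
  refine hom_eq_zero (χ := altLeft hf (Pi.single j 1) (Pi.single k 1)) (fun i => ?_) x
  change alt₃ f (Pi.single i 1) (Pi.single j 1) (Pi.single k 1) = 0
  rw [← alt₃_rotate, ← alt₃_rotate]
  exact h i j

/-- The character produced by descent is a combination of coordinate characters, and the φ_ik cancel
it term by term. -/
theorem exists_sub_sum_mem_B₃ {f : Gam n → Gam n → Gam n → Additive Circle}
    (hf : f ∈ Z₃ (Gam n) (Additive Circle)) {k : Fin m} (hp : pull (keep n {k}ᶜ) f = 0)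
    (h : ∀ i j, alt₃ f (Pi.single k 1) (Pi.single i 1) (Pi.single j 1) = 0) :
    ∃ s : Fin m → ℤ, f - ∑ i, s i • Phi₂ n i k ∈ B₃ (Gam n) (Additive Circle) := by
  have hce : Pi.evalAddMonoidHom (fun i => ZMod (n i)) k (Pi.single k 1) = 1 :=
    Pi.single_eq_same (M := fun i => ZMod (n i)) k 1
  obtain ⟨χ, hχ⟩ := exists_descent (c := Pi.evalAddMonoidHom (fun i => ZMod (n i)) k)
    (p := keep n {k}ᶜ) hce (nsmul_single k)
    (fun x => keep_of_notMem (by simp) x)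
    (fun g hg => by
      funext i
      by_cases hi : i = k
      · subst hi
        rw [keep_of_notMem (by simp)]
        exact hg.symm
      · exact keep_of_mem hi g)
    (keep_single_of_notMem (by simp) _) hf
    (fun x y z => congrFun (congrFun (congrFun hp x) y) z)
    (fun x y => alt₃_single_eq_zero hf h _ _)
  obtain ⟨s, hs⟩ := exists_sum_coordChar χ
  refine ⟨-s, mem_B₃_of_descent hce ?_⟩
  have h₁ := add_mem hχ (sum_mem fun i (_ : i ∈ Finset.univ) =>
    zsmul_mem (Phi₂_mem_descentGroup (n := n) i k) (s i))
  convert h₁ using 1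
  refine Prod.ext ?_ ?_
  · simp only [Prod.fst_add, Prod.fst_sum, Prod.smul_fst, Pi.neg_apply, neg_smul,
      Finset.sum_neg_distrib, sub_neg_eq_add]
  · simp only [Prod.snd_add, Prod.snd_sum, Prod.smul_snd, smul_neg, Finset.sum_neg_distrib, ← hs,
      add_neg_cancel]

theorem alt₃_Phi₃_single {i j k x y z : Fin m} (h₁ : i < j) (h₂ : j < k) (h₃ : x < y)
    (h₄ : y < z) : alt₃ (Phi₃ n i j k) (Pi.single x 1) (Pi.single y 1) (Pi.single z 1) =
      if i = x ∧ j = y ∧ k = z then zeta (gcd₃ n i j k) else 0 := by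
  have key : ∀ u v w : Fin m, ¬ (i = u ∧ j = v ∧ k = w) →
      Phi₃ n i j k (Pi.single u 1) (Pi.single v 1) (Pi.single w 1) = 0 := by
    intro u v w h
    apply Phi₃_of_eq_zero
    by_cases hu : i = u
    · by_cases hv : j = v
      · exact Or.inr (Or.inr (Pi.single_eq_of_ne (fun hw => h ⟨hu, hv, hw⟩) _))
      · exact Or.inr (Or.inl (Pi.single_eq_of_ne hv _))
    · exact Or.inl (Pi.single_eq_of_ne hu _)
  rw [alt₃, key x z y (by omega), key y z x (by omega), key y x z (by omega), key z x y (by omega),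
    key z y x (by omega)]
  split_ifs with h
  · obtain ⟨rfl, rfl, rfl⟩ := h
    rw [Phi₃_single]
    abel
  · rw [key x y z h]
    abel

/-- By additivity in each variable the value is killed by n_i, n_j and n_k, hence by their gcd. -/
theorem exists_alt₃_single_eq {f : Gam n → Gam n → Gam n → Additive Circle}
    (hf : f ∈ Z₃ (Gam n) (Additive Circle)) (i j k : Fin m) :
    ∃ s : ℤ, alt₃ f (Pi.single i 1) (Pi.single j 1) (Pi.single k 1) = s • zeta (gcd₃ n i j k) := by
  have key : ∀ (i : Fin m) (b c : Gam n), n i • alt₃ f (Pi.single i 1) b c = 0 := by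
    intro i b c
    change n i • altLeft hf b c (Pi.single i 1) = 0
    rw [← map_nsmul, nsmul_single, map_zero]
  have h₁ := key i (Pi.single j 1) (Pi.single k 1)
  have h₂ := key j (Pi.single k 1) (Pi.single i 1)
  have h₃ := key k (Pi.single i 1) (Pi.single j 1)
  rw [alt₃_rotate] at h₂
  rw [← alt₃_rotate] at h₃
  rw [← addOrderOf_dvd_iff_nsmul_eq_zero] at h₁ h₂ h₃
  apply exists_zsmul_zeta
  rw [natCast_zsmul, ← addOrderOf_dvd_iff_nsmul_eq_zero]
  exact Nat.dvd_gcd (Nat.dvd_gcd h₁ h₂) h₃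

end Coordinates

/-! ### Generation of all cocycles by the φ's -/

section Surjectivity

variable {m : ℕ} (n : Fin m → ℕ) [∀ i, NeZero (n i)]

/-- The group generated by the cochains `φᵢ`, `φᵢⱼ`, `φᵢⱼₖ` and the coboundaries. -/
def spanPhi : AddSubgroup (Gam n → Gam n → Gam n → Additive Circle) :=
  AddSubgroup.closure (Set.range (fun i => Phi₂ n i i) ∪
    Set.range (fun p : Pairs m => Phi₂ n p.1.1 p.1.2) ∪
    Set.range (fun p : Triples m => Phi₃ n p.1.1 p.1.2.1 p.1.2.2)) ⊔ B₃ (Gam n) (Additive Circle)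

variable {n}

theorem Phi₂_mem_spanPhi {i j : Fin m} (h : i ≤ j) : Phi₂ n i j ∈ spanPhi n := by
  refine AddSubgroup.mem_sup_left (AddSubgroup.subset_closure (Or.inl ?_))
  rcases h.eq_or_lt with rfl | h
  · exact Or.inl ⟨i, rfl⟩
  · exact Or.inr ⟨⟨(i, j), h⟩, rfl⟩

theorem Phi₃_mem_spanPhi {i j k : Fin m} (h : i < j) (h' : j < k) : Phi₃ n i j k ∈ spanPhi n :=
  AddSubgroup.mem_sup_left (AddSubgroup.subset_closure (Or.inr ⟨⟨(i, j, k), h, h'⟩, rfl⟩))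

theorem mem_spanPhi_of_mem_B₃ {f : Gam n → Gam n → Gam n → Additive Circle}
    (hf : f ∈ B₃ (Gam n) (Additive Circle)) : f ∈ spanPhi n :=
  AddSubgroup.mem_sup_right hf

theorem mem_spanPhi_of_pull_eq {f : Gam n → Gam n → Gam n → Additive Circle}
    (hf : f ∈ Z₃ (Gam n) (Additive Circle)) {k : Fin m} (hp : pull (keep n {k}ᶜ) f = 0)
    (hk : pull (keep n (Set.Iic k)) f = f) : f ∈ spanPhi n := by
  choose s hs using fun i j => exists_alt₃_single_eq hf i j k
  let g := ∑ i, ∑ j, if i < j ∧ j < k then s i j • Phi₃ n i j k else 0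
  have hgZ : g ∈ Z₃ (Gam n) (Additive Circle) := by
    refine sum_mem fun i _ => sum_mem fun j _ => ?_
    split_ifs with h
    · exact zsmul_mem (Phi₃_mem_Z₃ n i j k) _
    · exact zero_mem _
  have hgD : g ∈ spanPhi n := by
    refine sum_mem fun i _ => sum_mem fun j _ => ?_
    split_ifs with h
    · exact zsmul_mem (Phi₃_mem_spanPhi h.1 h.2) _
    · exact zero_mem _
  have hgp : pull (keep n {k}ᶜ) g = 0 := by
    simp only [g, map_sum]
    refine Finset.sum_eq_zero fun i _ => Finset.sum_eq_zero fun j _ => ?_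
    split_ifs with h
    · rw [map_zsmul, pull_keep_Phi₃_eq_zero (by simp), smul_zero]
    · exact map_zero _
  have hgk : pull (keep n (Set.Iic k)) g = g := by
    simp only [g, map_sum]
    refine Finset.sum_congr rfl fun i _ => Finset.sum_congr rfl fun j _ => ?_
    split_ifs with h
    · rw [map_zsmul, pull_keep_Phi₃ (P := Set.Iic k) (Set.mem_Iic.2 (h.1.trans h.2).le)
        (Set.mem_Iic.2 h.2.le) (Set.mem_Iic.2 le_rfl)]
    · exact map_zero _
  have hfgZ := sub_mem hf hgZ
  have hfgk : pull (keep n (Set.Iic k)) (f - g) = f - g := by rw [map_sub, hk, hgk]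
  have halt : ∀ i j, i < j → j < k →
      alt₃ (f - g) (Pi.single i 1) (Pi.single j 1) (Pi.single k 1) = 0 := by
    intro x y hx hy
    rw [← altHom_apply, map_sub, altHom_apply, hs]
    simp only [g, map_sum]
    rw [Finset.sum_eq_single x, Finset.sum_eq_single y, if_pos ⟨hx, hy⟩, map_zsmul, altHom_apply,
      alt₃_Phi₃_single hx hy hx hy, if_pos ⟨rfl, rfl, rfl⟩, sub_self]
    · intro j _ hj
      split_ifs with h
      · rw [map_zsmul, altHom_apply, alt₃_Phi₃_single h.1 h.2 hx hy, if_neg (fun h' => hj h'.2.1),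
          smul_zero]
      · exact map_zero _
    · exact fun h => absurd (Finset.mem_univ _) h
    · intro i _ hi
      refine Finset.sum_eq_zero fun j _ => ?_
      split_ifs with h
      · rw [map_zsmul, altHom_apply, alt₃_Phi₃_single h.1 h.2 hx hy, if_neg (fun h' => hi h'.1),
          smul_zero]
      · exact map_zero _
    · exact fun h => absurd (Finset.mem_univ _) h
  have hzero : ∀ (i : Fin m) (b c : Gam n), k < i → alt₃ (f - g) (Pi.single i 1) b c = 0 := by
    intro i b c hi
    have h₀ := map_zero (altLeft hfgZ (keep n (Set.Iic k) b) (keep n (Set.Iic k) c))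
    rw [← keep_single_of_notMem (n := n) (P := Set.Iic k) (i := i) (by simpa using hi) 1] at h₀
    rw [← hfgk]
    exact h₀
  -- The alternation at (e_k, e_i, e_j) vanishes for indices above k because f - g ignores those
  -- coordinates, for repeated indices by antisymmetry, and otherwise by the choice of g.
  obtain ⟨t, ht⟩ := exists_sub_sum_mem_B₃ hfgZ (k := k) (by rw [map_sub, hp, hgp, sub_zero])
    (fun i j => by
      rw [← alt₃_rotate]
      rcases lt_or_ge k i with hi | hi
      · exact hzero i _ _ hi
      rcases lt_or_ge k j with hj | hj
      · rw [← alt₃_rotate]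
        exact hzero j _ _ hj
      rcases hi.eq_or_lt with rfl | hi
      · rw [alt₃_rotate, alt₃_self]
      rcases hj.eq_or_lt with rfl | hj
      · rw [← alt₃_rotate, alt₃_self]
      rcases lt_trichotomy i j with h | rfl | h
      · exact halt i j h hj
      · exact alt₃_self _ _ _
      · rw [alt₃_swap, halt j i h hi, neg_zero])
  -- The sum also contains φ_ik with i > k, which are not among the generators; pulling back to the
  -- coordinates up to k kills them and fixes f - g.
  have hpull := pull_mem_B₃ (keep n (Set.Iic k)) ht
  rw [map_sub, hfgk, map_sum] at hpull
  have hsum : ∑ i, pull (keep n (Set.Iic k)) (t i • Phi₂ n i k) ∈ spanPhi n := by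
    refine sum_mem fun i _ => ?_
    rw [map_zsmul]
    refine zsmul_mem ?_ _
    by_cases hi : i ≤ k
    · rw [pull_keep_Phi₂ (P := Set.Iic k) hi (Set.mem_Iic.2 le_rfl)]
      exact Phi₂_mem_spanPhi hi
    · rw [pull_keep_Phi₂_eq_zero (Or.inl hi)]
      exact zero_mem _
  have := add_mem (add_mem (mem_spanPhi_of_mem_B₃ hpull) hsum) hgD
  rwa [sub_add_cancel, sub_add_cancel] at this

theorem pull_keep_mem_spanPhi {f : Gam n → Gam n → Gam n → Additive Circle}
    (hf : f ∈ Z₃ (Gam n) (Additive Circle)) (K : ℕ) :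
    pull (keep n {i | i.val < K}) f ∈ spanPhi n := by
  induction K with
  | zero =>
    have h₀ : f 0 0 0 = 0 := by
      have := hf 0 0 0 0
      simpa [d₃] using this
    have h : ∀ a, keep n {i | i.val < 0} a = 0 := fun a =>
      funext fun i => keep_of_notMem (Nat.not_lt_zero _) a
    have : pull (keep n {i | i.val < 0}) f = 0 := by
      funext a b c
      rw [pull_apply, h, h, h, h₀]
      rfl
    rw [this]
    exact zero_mem _
  | succ K ih =>
    by_cases hK : K < m
    · let k : Fin m := ⟨K, hK⟩
      have h₁ : {i : Fin m | i.val < K + 1} = Set.Iic k := by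
        ext i
        exact Nat.lt_succ_iff
      have h₂ : {i : Fin m | i.val < K} = Set.Iio k := rfl
      rw [h₂] at ih
      rw [h₁]
      have hinter₁ : Set.Iic k ∩ {k}ᶜ = Set.Iio k := by
        ext i; simp [lt_iff_le_and_ne]
      have hinter₂ : Set.Iio k ∩ {k}ᶜ = Set.Iio k := by
        ext i; simpa using fun h : i < k => h.ne
      have hinter₃ : Set.Iio k ∩ Set.Iic k = Set.Iio k := by
        ext i; simpa using fun h : i < k => h.le
      -- The difference of consecutive pullbacks vanishes when the k-th coordinate is set to 0.
      have h := mem_spanPhi_of_pull_eq (n := n) (k := k)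
        (f := pull (keep n (Set.Iic k)) f - pull (keep n (Set.Iio k)) f)
        (sub_mem (pull_mem_Z₃ _ hf) (pull_mem_Z₃ _ hf))
        (by rw [map_sub, pull_pull, pull_pull, keep_keep, keep_keep, hinter₁, hinter₂, sub_self])
        (by rw [map_sub, pull_pull, pull_pull, keep_keep, keep_keep, Set.inter_self, hinter₃])
      have := add_mem h ih
      rwa [sub_add_cancel] at this
    · have : {i : Fin m | i.val < K + 1} = {i | i.val < K} := by
        ext i
        have := i.isLt
        simp only [Set.mem_ofPred_eq]
        omega
      rwa [this]

theorem mem_spanPhi {f : Gam n → Gam n → Gam n → Additive Circle}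
    (hf : f ∈ Z₃ (Gam n) (Additive Circle)) : f ∈ spanPhi n := by
  have h := pull_keep_mem_spanPhi hf m
  have : {i : Fin m | i.val < m} = Set.univ := Set.eq_univ_of_forall fun i => i.isLt
  rw [this, keep_univ] at h
  exact h

end Surjectivity

/-! ### Independence of the φ's modulo coboundaries -/

section Injectivity

variable {m : ℕ} (n : Fin m → ℕ) [∀ i, NeZero (n i)]

/-- The cyclic sum, as a homomorphism in the cochain. -/
def cyclicSumHom {Γ A : Type} [AddCommGroup Γ] [AddCommGroup A] (L : ℕ) (g : Γ) :
    (Γ → Γ → Γ → A) →+ A :=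
  AddMonoidHom.mk' (fun f => cyclicSum f L g) fun f f' => by
    simp only [cyclicSum, Pi.add_apply, Finset.sum_add_distrib]

theorem mul_sum_omegaZMod (N : ℕ) [NeZero N] (x : ZMod N) (L : ℕ) (hL : L • x = 0) :
    (N : ℤ) * ∑ t ∈ Finset.range L, omegaZMod N x (t • x) = L * x.val := by
  have h : ∀ t : ℕ, (N : ℤ) * omegaZMod N x (t • x) =
      (x.val : ℤ) - (((((t + 1) • x).val : ℕ) : ℤ) - ((t • x).val : ℕ)) := by
    intro t
    rw [mul_omegaZMod, succ_nsmul']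
    ring
  rw [Finset.mul_sum, Finset.sum_congr rfl fun t _ => h t, Finset.sum_sub_distrib,
    Finset.sum_range_sub (fun t => (((t • x).val : ℕ) : ℤ)), hL, zero_smul]
  simp

variable {n}

/-- Around n_i d steps of size 1 in ℤ/n_i there are d carries. The case n_i = 1 is excluded because
there 1 lifts to 0. -/
theorem cyclicSum_Phi₂ {i : Fin m} (j : Fin m) (hi : n i ≠ 1) {g : Gam n} (hg : g i = 1) (d : ℕ) :
    cyclicSum (Phi₂ n i j) (n i * d) g = (d : ℤ) • coordChar n j g := by
  have hL : (n i * d) • g i = 0 := by simp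
  have h := mul_sum_omegaZMod (n i) (g i) _ hL
  have hN : (n i : ℤ) ≠ 0 := Nat.cast_ne_zero.2 (NeZero.ne (n i))
  have h₁ : (g i).val = 1 := by
    have : Fact (1 < n i) := ⟨by have := NeZero.ne (n i); omega⟩
    rw [hg, ZMod.val_one]
  rw [h₁, Nat.cast_mul, Nat.cast_one, mul_one] at h
  rw [← mul_left_cancel₀ hN h, Finset.sum_smul]
  exact Finset.sum_congr rfl fun t _ => Phi₂_eq n i j _ _ _

theorem cyclicSum_Phi₂_eq_zero {i j : Fin m} {g : Gam n} (h : g i = 0 ∨ g j = 0) (L : ℕ) :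
    cyclicSum (Phi₂ n i j) L g = 0 :=
  Finset.sum_eq_zero fun t _ => Phi₂_of_eq_zero n (by
    rcases h with h | h
    · exact Or.inl h
    · exact Or.inr (Or.inr h))

theorem zsmul_cyclicSum_Phi₂ (i j : Fin m) (L : ℕ) (g : Gam n) :
    (n j : ℤ) • cyclicSum (Phi₂ n i j) L g = 0 := by
  change (n j : ℤ) • cyclicSumHom L g (Phi₂ n i j) = 0
  rw [← map_zsmul, zsmul_right_Phi₂, map_zero]

theorem cyclicSum_Phi₃_eq_zero {i j k : Fin m} {g : Gam n} (h : g i = 0 ∨ g j = 0 ∨ g k = 0)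
    (L : ℕ) : cyclicSum (Phi₃ n i j k) L g = 0 :=
  Finset.sum_eq_zero fun t _ => Phi₃_of_eq_zero n (by
    rcases h with h | h | h
    · exact Or.inl h
    · exact Or.inr (Or.inl (by rw [Pi.smul_apply, h, smul_zero]))
    · exact Or.inr (Or.inr h))

theorem alt₃_Phi₂_single (i j : Fin m) {x y z : Fin m} (hxy : x < y) (hyz : y < z) :
    alt₃ (Phi₂ n i j) (Pi.single x 1) (Pi.single y 1) (Pi.single z 1) = 0 := by
  have key : ∀ u v w : Fin m, u ≠ v →
      Phi₂ n i j (Pi.single u 1) (Pi.single v 1) (Pi.single w 1) = 0 := by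
    intro u v w h
    apply Phi₂_of_eq_zero
    by_cases hu : i = u
    · exact Or.inr (Or.inl (Pi.single_eq_of_ne (hu ▸ h) _))
    · exact Or.inl (Pi.single_eq_of_ne hu _)
  rw [alt₃, key _ _ _ hxy.ne, key _ _ _ hyz.ne, key _ _ _ hxy.ne', key _ _ _ hyz.ne',
    key _ _ _ (hxy.trans hyz).ne, key _ _ _ (hxy.trans hyz).ne']
  simp

theorem eq_zero_of_dvd_val {N : ℕ} [NeZero N] {x : ZMod N} (h : (N : ℤ) ∣ x.val) : x = 0 := by
  rw [← ZMod.natCast_zmod_val x, ← Int.cast_natCast, ZMod.intCast_zmod_eq_zero_iff_dvd]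
  exact h

theorem coeff_eq_zero {r : Fin m → ℤ} {s : Pairs m → ℤ} {t : Triples m → ℤ}
    (h : ∑ i, r i • Phi₂ n i i + (∑ p, s p • Phi₂ n p.1.1 p.1.2 +
      ∑ p, t p • Phi₃ n p.1.1 p.1.2.1 p.1.2.2) ∈ B₃ (Gam n) (Additive Circle)) :
    (∀ i, (n i : ℤ) ∣ r i) ∧ (∀ p, (gcd₂ n p.1.1 p.1.2 : ℤ) ∣ s p) ∧
      ∀ p, (gcd₃ n p.1.1 p.1.2.1 p.1.2.2 : ℤ) ∣ t p := by
  obtain ⟨ψ, hψ⟩ := h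
  have hcyc : ∀ (L : ℕ) (g : Gam n), L • g = 0 → ∑ i, r i • cyclicSum (Phi₂ n i i) L g +
      (∑ p : Pairs m, s p • cyclicSum (Phi₂ n p.1.1 p.1.2) L g +
        ∑ p : Triples m, t p • cyclicSum (Phi₃ n p.1.1 p.1.2.1 p.1.2.2) L g) = 0 := by
    intro L g hg
    have := congrArg (cyclicSumHom L g) hψ.symm
    simp only [map_add, map_sum, map_zsmul] at this
    exact this.trans (cyclicSum_d₂ ψ hg)
  have h₁ : ∀ i, (n i : ℤ) ∣ r i := by
    intro i
    by_cases hi : n i = 1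
    · rw [hi]; exact one_dvd _
    have hne : ∀ j, j ≠ i → (Pi.single i 1 : Gam n) j = 0 := fun j hj => Pi.single_eq_of_ne hj _
    -- Only φ_i survives at e_i, since every other generator involves a coordinate where e_i is 0.
    have := hcyc (n i) (Pi.single i 1) (nsmul_single i)
    rw [Finset.sum_eq_single i, Finset.sum_eq_zero, Finset.sum_eq_zero, add_zero, add_zero] at this
    · have hv := cyclicSum_Phi₂ i hi (Pi.single_eq_same (M := fun i => ZMod (n i)) i 1) 1
      rw [mul_one, coordChar_single, Nat.cast_one, one_smul] at hv
      rw [hv] at this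
      exact (zsmul_zeta_eq_zero_iff _ _).1 this
    · rintro ⟨⟨u, v, w⟩, huv, hvw⟩ _
      dsimp only at huv hvw ⊢
      rw [cyclicSum_Phi₃_eq_zero, smul_zero]
      by_cases hu : u = i
      · exact Or.inr (Or.inr (hne w (by omega)))
      · exact Or.inl (hne u hu)
    · rintro ⟨⟨u, v⟩, huv⟩ _
      dsimp only at huv ⊢
      rw [cyclicSum_Phi₂_eq_zero, smul_zero]
      by_cases hu : u = i
      · exact Or.inr (hne v (by omega))
      · exact Or.inl (hne u hu)
    · intro j _ hj
      rw [cyclicSum_Phi₂_eq_zero (Or.inl (hne j hj)), smul_zero]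
    · exact fun h => absurd (Finset.mem_univ _) h
  have h₃ : ∀ p : Triples m, (gcd₃ n p.1.1 p.1.2.1 p.1.2.2 : ℤ) ∣ t p := by
    rintro ⟨⟨x, y, z⟩, hxy, hyz⟩
    dsimp only at hxy hyz
    have := congrArg (altHom (Pi.single x 1) (Pi.single y 1) (Pi.single z 1)) hψ.symm
    simp only [map_add, map_sum, map_zsmul, altHom_apply, alt₃_Phi₂_single _ _ hxy hyz, alt₃_d₂,
      smul_zero, Finset.sum_const_zero, zero_add] at this
    rw [Finset.sum_eq_single ⟨(x, y, z), hxy, hyz⟩] at this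
    · rw [alt₃_Phi₃_single hxy hyz hxy hyz, if_pos ⟨rfl, rfl, rfl⟩] at this
      exact (zsmul_zeta_eq_zero_iff _ _).1 this
    · rintro ⟨⟨u, v, w⟩, huv, hvw⟩ _ hne
      rw [alt₃_Phi₃_single huv hvw hxy hyz, if_neg, smul_zero]
      rintro ⟨h₁, h₂, h₃⟩
      dsimp only at h₁ h₂ h₃
      subst h₁ h₂ h₃
      exact hne rfl
    · exact fun h => absurd (Finset.mem_univ _) h
  refine ⟨h₁, ?_, h₃⟩
  rintro ⟨⟨x, y⟩, hxy⟩
  dsimp only at hxy ⊢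
  by_cases hx : n x = 1
  · rw [gcd₂, hx, Nat.gcd_one_left]; exact one_dvd _
  -- The cyclic sum at e_x + e_y has length n_x d, the lcm of n_x and n_y, with n_y = (n_x, n_y) d.
  -- The φ_i terms vanish since n_i divides r_i; what remains says n_y divides s d, and cancelling d
  -- gives the claim.
  let g : Gam n := Pi.single x 1 + Pi.single y 1
  have hgx : g x = 1 := by
    simp [g, Pi.single_eq_of_ne hxy.ne]
  have hgne : ∀ j, j ≠ x → j ≠ y → g j = 0 := fun j hj hj' => by
    simp [g, Pi.single_eq_of_ne hj, Pi.single_eq_of_ne hj']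
  have hgy : coordChar n y g = zeta (n y) := by
    rw [map_add, coordChar_single, coordChar_of_eq_zero n (Pi.single_eq_of_ne hxy.ne' _), zero_add]
  obtain ⟨d, hd⟩ := Nat.gcd_dvd_right (n x) (n y)
  have hL : (n x * d) • g = 0 := by
    obtain ⟨d', hd'⟩ := Nat.gcd_dvd_left (n x) (n y)
    have : n x * d = n y * d' := by
      conv_lhs => rw [hd']
      conv_rhs => rw [hd]
      ring
    rw [smul_add, mul_comm, mul_smul, nsmul_single, smul_zero, mul_comm, this, mul_comm, mul_smul,
      nsmul_single, smul_zero, add_zero]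
  have := hcyc _ g hL
  rw [Finset.sum_eq_zero, Finset.sum_eq_single ⟨(x, y), hxy⟩, Finset.sum_eq_zero, add_zero,
    zero_add] at this
  · dsimp only at this
    rw [cyclicSum_Phi₂ y hx hgx, hgy, ← mul_smul, zsmul_zeta_eq_zero_iff] at this
    have hd0 : (d : ℤ) ≠ 0 := by
      rintro h0
      apply NeZero.ne (n y)
      rw [hd, Nat.cast_eq_zero.1 h0, mul_zero]
    refine Int.dvd_of_mul_dvd_mul_right hd0 ?_
    rwa [gcd₂, ← Nat.cast_mul, ← hd]
  · rintro ⟨⟨u, v, w⟩, huv, hvw⟩ _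
    dsimp only at huv hvw ⊢
    rw [cyclicSum_Phi₃_eq_zero, smul_zero]
    by_contra! hc
    have key : ∀ j, g j ≠ 0 → j = x ∨ j = y := fun j hj => by
      by_contra! h
      exact hj (hgne j h.1 h.2)
    have hu := key u hc.1
    have hv := key v hc.2.1
    have hw := key w hc.2.2
    omega
  · rintro ⟨⟨u, v⟩, huv⟩ _ hne
    dsimp only at huv ⊢
    rw [cyclicSum_Phi₂_eq_zero, smul_zero]
    by_contra! hc
    have hu : u = x ∨ u = y := by
      by_contra! h
      exact hc.1 (hgne u h.1 h.2)
    have hv : v = x ∨ v = y := by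
      by_contra! h
      exact hc.2 (hgne v h.1 h.2)
    refine hne (Subtype.ext (Prod.ext ?_ ?_)) <;> dsimp only <;> omega
  · exact fun h => absurd (Finset.mem_univ _) h
  · intro i _
    obtain ⟨q, hq⟩ := h₁ i
    rw [hq, mul_comm, mul_smul, zsmul_cyclicSum_Phi₂, smul_zero]

end Injectivity

/-! ### The isomorphism -/

section Isomorphism

variable {m : ℕ} (n : Fin m → ℕ) [∀ i, NeZero (n i)]

/-- The cohomology class of `φᵢⱼ`. -/
def class₂ (i j : Fin m) : H3 (Gam n) := classHom (Gam n) ⟨Phi₂ n i j, Phi₂_mem_Z₃ n i j⟩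

/-- The cohomology class of `φᵢⱼₖ`. -/
def class₃ (i j k : Fin m) : H3 (Gam n) := classHom (Gam n) ⟨Phi₃ n i j k, Phi₃_mem_Z₃ n i j k⟩

theorem zsmul_class₂ (i j : Fin m) : (gcd₂ n i j : ℤ) • class₂ n i j = 0 := by
  rw [class₂, ← map_zsmul, classHom_eq_zero_iff]
  exact zsmul_gcd_Phi₂ n i j

theorem zsmul_class₂_self (i : Fin m) : (n i : ℤ) • class₂ n i i = 0 := by
  have := zsmul_class₂ n i i
  rwa [gcd₂, Nat.gcd_self] at this

theorem zsmul_class₃ (i j k : Fin m) : (gcd₃ n i j k : ℤ) • class₃ n i j k = 0 := by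
  rw [class₃, ← map_zsmul, classHom_eq_zero_iff]
  change (gcd₃ n i j k : ℤ) • Phi₃ n i j k ∈ _
  rw [zsmul_gcd_Phi₃]
  exact zero_mem _

/-- The homomorphism out of `⨁ ℤ/N` given by elements killed by the `N`. -/
def sumLift {ι M : Type} [DecidableEq ι] [AddCommGroup M] (N : ι → ℕ) (x : ι → M)
    (hx : ∀ i, (N i : ℤ) • x i = 0) : (⨁ i, ZMod (N i)) →+ M :=
  DirectSum.toAddMonoid fun i => ZMod.lift (N i) ⟨zmultiplesHom M (x i), hx i⟩

theorem sumLift_of_one {ι M : Type} [DecidableEq ι] [AddCommGroup M] (N : ι → ℕ) (x : ι → M)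
    (hx : ∀ i, (N i : ℤ) • x i = 0) (i : ι) :
    sumLift N x hx (DirectSum.of (fun i => ZMod (N i)) i 1) = x i := by
  rw [sumLift, DirectSum.toAddMonoid_of, ← Int.cast_one, ZMod.lift_coe]
  simp

theorem sumLift_apply {ι M : Type} [DecidableEq ι] [Fintype ι] [AddCommGroup M] (N : ι → ℕ)
    [∀ i, NeZero (N i)] (x : ι → M) (hx : ∀ i, (N i : ℤ) • x i = 0) (a : ⨁ i, ZMod (N i)) :
    sumLift N x hx a = ∑ i, ((a i).val : ℤ) • x i := by
  conv_lhs => rw [← DirectSum.sum_univ_of a, map_sum]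
  refine Finset.sum_congr rfl fun i _ => ?_
  have h : ∀ r : ℤ, ZMod.lift (N i) ⟨zmultiplesHom M (x i), hx i⟩ r = r • x i := fun r => by
    rw [ZMod.lift_coe]
    rfl
  have h' := h (a i).val
  rw [Int.cast_natCast, ZMod.natCast_zmod_val] at h'
  rw [sumLift, DirectSum.toAddMonoid_of, h']

/-- The homomorphism sending the generators to the classes of `φᵢ`, `φᵢⱼ` and `φᵢⱼₖ`. -/
def targetHom : Target n →+ H3 (Gam n) :=
  (sumLift n (fun i => class₂ n i i) (zsmul_class₂_self n)).coprod
    ((sumLift _ (fun p : Pairs m => class₂ n p.1.1 p.1.2) fun _ => zsmul_class₂ n _ _).coprod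
      (sumLift _ (fun p : Triples m => class₃ n p.1.1 p.1.2.1 p.1.2.2)
        fun _ => zsmul_class₃ n _ _ _))

theorem targetHom_gen₁ (i : Fin m) : targetHom n (gen₁ n i) = class₂ n i i := by
  simp only [targetHom, gen₁, AddMonoidHom.coprod_apply, map_zero, add_zero]
  exact sumLift_of_one n _ _ i

theorem targetHom_gen₂ (p : Pairs m) : targetHom n (gen₂ n p) = class₂ n p.1.1 p.1.2 := by
  simp only [targetHom, gen₂, AddMonoidHom.coprod_apply, map_zero, add_zero, zero_add]
  exact sumLift_of_one _ (fun p : Pairs m => class₂ n p.1.1 p.1.2) _ p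

theorem targetHom_gen₃ (p : Triples m) :
    targetHom n (gen₃ n p) = class₃ n p.1.1 p.1.2.1 p.1.2.2 := by
  simp only [targetHom, gen₃, AddMonoidHom.coprod_apply, map_zero, zero_add]
  exact sumLift_of_one _ (fun p : Triples m => class₃ n p.1.1 p.1.2.1 p.1.2.2) _ p

theorem targetHom_injective : Function.Injective (targetHom n) := by
  rw [injective_iff_map_eq_zero]
  rintro ⟨a, b, c⟩ h
  have : ∀ p : Pairs m, NeZero (gcd₂ n p.1.1 p.1.2) := fun p =>
    ⟨Nat.gcd_ne_zero_left (NeZero.ne _)⟩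
  simp only [targetHom, AddMonoidHom.coprod_apply, sumLift_apply, class₂, class₃, ← map_zsmul,
    ← map_sum, ← map_add] at h
  rw [classHom_eq_zero_iff] at h
  simp only [AddSubgroup.coe_add, AddSubgroup.val_finsetSum, AddSubgroup.coe_zsmul] at h
  obtain ⟨h₁, h₂, h₃⟩ := coeff_eq_zero h
  refine Prod.ext (DFinsupp.ext fun i => ?_)
    (Prod.ext (DFinsupp.ext fun p => ?_) (DFinsupp.ext fun p => ?_))
  · exact eq_zero_of_dvd_val (h₁ i)
  · exact eq_zero_of_dvd_val (h₂ p)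
  · exact eq_zero_of_dvd_val (h₃ p)

theorem targetHom_surjective : Function.Surjective (targetHom n) := by
  have h : spanPhi n ≤ ((targetHom n).range.comap (classHom (Gam n))).map
      (Z₃ (Gam n) (Additive Circle)).subtype := by
    refine sup_le ((AddSubgroup.closure_le _).2 ?_) fun f hf => ?_
    · rintro _ ((⟨i, rfl⟩ | ⟨p, rfl⟩) | ⟨p, rfl⟩)
      · exact ⟨⟨_, Phi₂_mem_Z₃ n i i⟩, ⟨_, targetHom_gen₁ n i⟩, rfl⟩
      · exact ⟨⟨_, Phi₂_mem_Z₃ n _ _⟩, ⟨_, targetHom_gen₂ n p⟩, rfl⟩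
      · exact ⟨⟨_, Phi₃_mem_Z₃ n _ _ _⟩, ⟨_, targetHom_gen₃ n p⟩, rfl⟩
    · exact ⟨⟨f, B₃_le_Z₃ hf⟩, ⟨0, (map_zero _).trans ((classHom_eq_zero_iff _).2 hf).symm⟩, rfl⟩
  intro x
  obtain ⟨f, rfl⟩ := classHom_surjective x
  obtain ⟨f', hf', hff'⟩ := h (mem_spanPhi f.2)
  obtain rfl : f' = f := Subtype.ext hff'
  exact hf'

end Isomorphism

end ThirdCohomology

end

theorem mainTheorem10 (m : ℕ) (n : Fin m → ℕ) [∀ i, NeZero (n i)] :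
    ∃ (h₁ : ∀ i : Fin m, ThirdCohomology.IsCocycle (ThirdCohomology.phi₁ n i))
      (h₂ : ∀ p : ThirdCohomology.Pairs m,
        ThirdCohomology.IsCocycle (ThirdCohomology.phi₂ n p.1.1 p.1.2))
      (h₃ : ∀ p : ThirdCohomology.Triples m,
        ThirdCohomology.IsCocycle (ThirdCohomology.phi₃ n p.1.1 p.1.2.1 p.1.2.2))
      (e : ThirdCohomology.Target n ≃+ ThirdCohomology.H3 (ThirdCohomology.Gam n)),
      (∀ i : Fin m, e (ThirdCohomology.gen₁ n i) =
        ThirdCohomology.cohomologyClass (ThirdCohomology.phi₁ n i) (h₁ i)) ∧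
      (∀ p : ThirdCohomology.Pairs m, e (ThirdCohomology.gen₂ n p) =
        ThirdCohomology.cohomologyClass (ThirdCohomology.phi₂ n p.1.1 p.1.2) (h₂ p)) ∧
      (∀ p : ThirdCohomology.Triples m, e (ThirdCohomology.gen₃ n p) =
        ThirdCohomology.cohomologyClass
          (ThirdCohomology.phi₃ n p.1.1 p.1.2.1 p.1.2.2) (h₃ p)) :=
  -- φ_i and φ_ii agree by definition.
  ⟨fun i => ThirdCohomology.isCocycle_iff.2 (ThirdCohomology.Phi₂_mem_Z₃ n i i),
    fun _ => ThirdCohomology.isCocycle_iff.2 (ThirdCohomology.Phi₂_mem_Z₃ n _ _),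
    fun _ => ThirdCohomology.isCocycle_iff.2 (ThirdCohomology.Phi₃_mem_Z₃ n _ _ _),
    AddEquiv.ofBijective (ThirdCohomology.targetHom n)
      ⟨ThirdCohomology.targetHom_injective n, ThirdCohomology.targetHom_surjective n⟩,
    ThirdCohomology.targetHom_gen₁ n, ThirdCohomology.targetHom_gen₂ n,
    ThirdCohomology.targetHom_gen₃ n⟩
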